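/- There is a universal constant $K>0$ such that the following holds for every finite connected simple graph $G$ with $n\ge 2$ vertices and $m$ edges. Write $d(v)$ for the degree of the vertex $v$, and let $\nu = n\sum_{v} d(v)^2/(2m)^2$. The lazy random walk on $G$ stays at its current vertex $v$ with probability $1/2$ and otherwise moves to a uniformly random neighbour of $v$; let $\lambda_2$ be the second largest eigenvalue (counted with multiplicity) of its transition matrix. Start one particle at each vertex; at each discrete time step all particles make independent steps of the lazy random walk, and whenever two or more particles meet at a vertex they unite to form a single particle, which continues as one lazy random walk. Let $C(n)$ be the expected number of steps until only one particle remains. Then $$C(n)\le \frac{K}{1-\lambda_2}\left(\log^4 n+\frac{n}{\nu}\right).$$ In the lazy voter model, initially all vertices have distinct opinions, and at each step all vertices simultaneously and independently keep their own opinion with probability $1/2$ and otherwise adopt the current opinion of a uniformly random neighbour. The expected number of steps $\mathbf{E}(C_{\underline{v}})$ until all vertices have the same opinion satisfies $\mathbf{E}(C_{\underline{v}})=C(n)$, and hence has the same upper bound. -/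

import Mathlib

open MeasureTheory
open scoped ENNReal

noncomputable section

/-- One step of the lazy random walk from `v`: with probability `1/2` stay at `v`, otherwise move
to a uniformly random neighbour of `v`. (An isolated vertex, absent from connected graphs with at
least two vertices, is never left.) -/
def lazyStep {V : Type*} [Fintype V] (G : SimpleGraph V) [DecidableRel G.Adj] (v : V) : PMF V :=
  (PMF.uniformOfFintype Bool).bind fun stay =>
    if stay then PMF.pure v
    else if h : (G.neighborFinset v).Nonempty then PMF.uniformOfFinset (G.neighborFinset v) h
    else PMF.pure v

/-- The transition matrix of the lazy random walk on `G`. -/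
def lazyMatrix {V : Type*} [Fintype V] (G : SimpleGraph V) [DecidableRel G.Adj] : Matrix V V ℝ :=
  Matrix.of fun v w => (lazyStep G v w).toReal

/-- `λ₂`: the second entry in the list `λ₁ ≥ λ₂ ≥ ⋯` of the eigenvalues, with multiplicity, of the
transition matrix of the lazy random walk. -/
def lambdaTwo {V : Type*} [Fintype V] [DecidableEq V] (G : SimpleGraph V) [DecidableRel G.Adj] :
    ℝ :=
  ((lazyMatrix G).charpoly.roots.sort (· ≥ ·)).getD 1 0

/-- `ν = n ∑ᵥ d(v)² / (2m)²`. -/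
def degreeVariability {V : Type*} [Fintype V] [DecidableEq V] (G : SimpleGraph V)
    [DecidableRel G.Adj] : ℝ :=
  (Fintype.card V : ℝ) * (∑ v, (G.degree v : ℝ) ^ 2) / (2 * (G.edgeFinset.card : ℝ)) ^ 2

/-- The law of the moves `ξ : ℕ → V → V`: the vertices `ξ t v` are independent, over all times `t`
and all vertices `v`, and `ξ t v` is distributed as a lazy step from `v`. -/
def moveLaw {V : Type*} [Fintype V] [MeasurableSpace V] (G : SimpleGraph V)
    [DecidableRel G.Adj] : Measure (ℕ → V → V) :=
  Measure.infinitePi fun _ : ℕ => Measure.pi fun v : V => (lazyStep G v).toMeasure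

/-- The set of vertices that carry a particle at time `t`. Initially there is one particle at each
vertex. In step `t` the particle at `v`, if there is one, moves to `ξ t v`, and particles that
arrive at the same vertex unite to form a single particle. -/
def occupied {V : Type*} [Fintype V] [DecidableEq V] (ξ : ℕ → V → V) : ℕ → Finset V
  | 0 => Finset.univ
  | t + 1 => (occupied ξ t).image (ξ t)

/-- The first time at which only one particle is left (`∞` if there is none). -/
def coalescenceTime {V : Type*} [Fintype V] [DecidableEq V] (ξ : ℕ → V → V) : ℝ≥0∞ :=
  ⨅ (t : ℕ) (_ : (occupied ξ t).card = 1), (t : ℝ≥0∞)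

/-- `C(n)`: the expected coalescence time of lazy random walks on `G`, one started per vertex. -/
def expectedCoalescenceTime {V : Type*} [Fintype V] [DecidableEq V] [MeasurableSpace V]
    (G : SimpleGraph V) [DecidableRel G.Adj] : ℝ≥0∞ :=
  ∫⁻ ξ, coalescenceTime ξ ∂(moveLaw G)

/-- The opinion of each vertex at time `t` in the voter model. Initially all opinions are
distinct. In step `t` each vertex `v` adopts the current opinion of the vertex `ξ t v`. -/
def opinion {V : Type*} (ξ : ℕ → V → V) : ℕ → V → V
  | 0 => fun v => v
  | t + 1 => fun v => opinion ξ t (ξ t v)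

/-- The first time at which all vertices have the same opinion (`∞` if there is none). -/
def votingTime {V : Type*} (ξ : ℕ → V → V) : ℝ≥0∞ :=
  ⨅ (t : ℕ) (_ : ∃ a, ∀ v, opinion ξ t v = a), (t : ℝ≥0∞)

/-- The expected time to complete voting in the lazy voter model on `G`. -/
def expectedVotingTime {V : Type*} [Fintype V] [MeasurableSpace V]
    (G : SimpleGraph V) [DecidableRel G.Adj] : ℝ≥0∞ :=
  ∫⁻ ξ, votingTime ξ ∂(moveLaw G)

end

/-!
Let `π = d / 2m` be the stationary distribution of the lazy walk and `p = ∑ π² = ν / n`.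

**Meeting of `2h` particles.** As long as no two of `2h` coalescing particles have met, they are
`2h` independent walks. The lazy walk contracts the mean square around the mean by the factor `λ₂²`
(`lazyMatrix_l2Contracts`), and so does the product of any number of copies of it
(`L2Contracts.pi`). By Cauchy–Schwarz, the chain killed on a set of stationary mass `q` loses at
least the fraction `(1 - λ₂²) q` of its square norm per step, and mixing from an arbitrary start
costs `O(h log n / (1 - λ₂))` steps (`killed_le`). By the second moment method, the mass `q` of the
collisions among `2h` independent samples from `π` is of order at least `min (1, h² p)`
(`collision_lower_bound`). Hence `2h` particles have a meeting with probability at least `1/2` after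
`O((h log n + 1 / (h² p)) / (1 - λ₂))` steps (`exists_meeting_time`).

**Coalescence.** While there are many particles, they are divided into groups of `2H` particles,
where `H = ⌈log n⌉`. In each meeting time each group loses a particle with probability at least
`1/2`, so that the mean number of particles decreases geometrically, and `O(H log n)` meeting times
reduce it to `O(H)` (`setStep_pow_mul_cardReal_le`). The rest of the particles are lost one by one.
Both phases take `O((log⁴ n + 1 / p) / (1 - λ₂))` steps in the mean, because `∑ 1 / h²` converges
(`truncatedTime_le_phases`, `truncatedTime_bound`).

The set of occupied vertices is studied as a Markov chain with transition operator `setStep`, by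
finite sums; `lintegral_occupied` connects it with the law of the moves.

**Voting.** The opinions at time `t` are the composition of the first `t` moves in the order
opposite to that of the coalescing walks, and the law of the moves is invariant under a permutation of the
times (`occupied_timeReversal`, `expectedVotingTime_eq`).
-/

noncomputable section

/-! ### Contraction in mean square -/

/-- `Q` contracts the mean square around the `μ`-mean by the factor `c`. If `μ` is a stationary
distribution of the transition matrix `Q`, this says that `Q` maps a function of mean zero to one
whose square norm in `L²(μ)` is at most `c` times as large. -/
def L2Contracts {X : Type*} [Fintype X] (μ : X → ℝ) (Q : Matrix X X ℝ) (c : ℝ) : Prop :=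
  ∀ f : X → ℝ, ∑ x, μ x * (Q.mulVec f) x ^ 2 ≤
    c * ∑ x, μ x * f x ^ 2 + (1 - c) * (∑ x, μ x * f x) ^ 2

/-- The square norm of the interaction term in the two-way analysis of variance, which is the
difference of the two sides, is nonnegative. -/
lemma interaction_nonneg {X Y : Type*} [Fintype X] [Fintype Y] (μ : X → ℝ) (ν : Y → ℝ)
    (hμ : ∀ x, 0 ≤ μ x) (hν : ∀ y, 0 ≤ ν y) (hμ1 : ∑ x, μ x = 1) (hν1 : ∑ y, ν y = 1)
    (f : X → Y → ℝ) :
    ∑ x, μ x * (∑ y, ν y * f x y) ^ 2 + ∑ y, ν y * (∑ x, μ x * f x y) ^ 2 ≤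
      ∑ x, ∑ y, μ x * ν y * f x y ^ 2 + (∑ x, μ x * ∑ y, ν y * f x y) ^ 2 := by
  set a : X → ℝ := fun x => ∑ y, ν y * f x y with ha
  set b : Y → ℝ := fun y => ∑ x, μ x * f x y with hb
  set m := ∑ x, μ x * a x with hm
  have hm' : ∑ y, ν y * b y = m := by
    simp only [hm, ha, hb, Finset.mul_sum]
    rw [Finset.sum_comm]
    refine Finset.sum_congr rfl fun x _ => Finset.sum_congr rfl fun y _ => by ring
  have h0 : 0 ≤ ∑ x, μ x * ∑ y, ν y * (f x y - a x - b y + m) ^ 2 :=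
    Finset.sum_nonneg fun x _ => mul_nonneg (hμ x) <|
      Finset.sum_nonneg fun y _ => mul_nonneg (hν y) (sq_nonneg _)
  -- expansion of the square, one variable at a time
  have h1 : ∀ x, ∑ y, ν y * (f x y - a x - b y + m) ^ 2 =
      ∑ y, ν y * f x y ^ 2 + ∑ y, ν y * b y ^ 2 - 2 * ∑ y, ν y * b y * f x y
        - a x ^ 2 + 2 * m * a x - m ^ 2 := by
    intro x
    have e : ∀ y, ν y * (f x y - a x - b y + m) ^ 2 =
        ν y * f x y ^ 2 + ν y * b y ^ 2 - 2 * (ν y * b y * f x y)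
          + 2 * (m - a x) * (ν y * f x y) + 2 * (a x - m) * (ν y * b y)
          + ν y * (m - a x) ^ 2 := fun y => by ring
    simp only [e, Finset.sum_add_distrib, Finset.sum_sub_distrib, ← Finset.mul_sum,
      ← Finset.sum_mul]
    rw [hν1, hm', show ∑ y, ν y * f x y = a x from rfl]
    ring
  have h2 : ∑ x, μ x * ∑ y, ν y * b y * f x y = ∑ y, ν y * b y ^ 2 := by
    simp only [Finset.mul_sum]
    rw [Finset.sum_comm]
    refine Finset.sum_congr rfl fun y _ => ?_
    rw [pow_two, ← mul_assoc]
    conv_rhs => rw [show b y = ∑ x, μ x * f x y from rfl, Finset.mul_sum]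
    exact Finset.sum_congr rfl fun x _ => by ring
  have h3 : ∑ x, μ x * ∑ y, ν y * (f x y - a x - b y + m) ^ 2 =
      ∑ x, μ x * ∑ y, ν y * f x y ^ 2 - ∑ y, ν y * b y ^ 2 - ∑ x, μ x * a x ^ 2 + m ^ 2 := by
    simp only [h1]
    have e : ∀ x, μ x * (∑ y, ν y * f x y ^ 2 + ∑ y, ν y * b y ^ 2 - 2 * ∑ y, ν y * b y * f x y
        - a x ^ 2 + 2 * m * a x - m ^ 2) = μ x * (∑ y, ν y * f x y ^ 2)
        + μ x * (∑ y, ν y * b y ^ 2) - 2 * (μ x * ∑ y, ν y * b y * f x y)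
        - μ x * a x ^ 2 + 2 * m * (μ x * a x) - μ x * m ^ 2 := fun x => by ring
    simp only [e, Finset.sum_add_distrib, Finset.sum_sub_distrib]
    rw [← Finset.sum_mul, ← Finset.sum_mul, ← Finset.mul_sum, ← Finset.mul_sum, h2, hμ1, ← hm]
    ring
  have h4 : ∑ x, ∑ y, μ x * ν y * f x y ^ 2 = ∑ x, μ x * ∑ y, ν y * f x y ^ 2 := by
    simp only [Finset.mul_sum, mul_assoc]
  rw [h4]
  linarith

/-- The contraction factor of two independent chains run side by side is the larger of the two
factors. -/
lemma L2Contracts.prod {X Y : Type*} [Fintype X] [Fintype Y] {μ : X → ℝ} {ν : Y → ℝ}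
    {Q : Matrix X X ℝ} {R : Matrix Y Y ℝ} {c : ℝ} (hc0 : 0 ≤ c) (hc1 : c ≤ 1)
    (hμ : ∀ x, 0 ≤ μ x) (hν : ∀ y, 0 ≤ ν y) (hμ1 : ∑ x, μ x = 1) (hν1 : ∑ y, ν y = 1)
    (hQ : L2Contracts μ Q c) (hR : L2Contracts ν R c) :
    L2Contracts (fun z : X × Y => μ z.1 * ν z.2) (fun z w => Q z.1 w.1 * R z.2 w.2) c := by
  intro f
  set g : X → Y → ℝ := fun x y => ∑ y', R y y' * f (x, y') with hg
  have hQf : ∀ x y, (Matrix.mulVec (fun z w : X × Y => Q z.1 w.1 * R z.2 w.2) f) (x, y) =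
      Q.mulVec (fun x' => g x' y) x := by
    intro x y
    simp only [Matrix.mulVec, dotProduct, Fintype.sum_prod_type, hg, Finset.mul_sum, mul_assoc]
  have hg1 : ∀ x, ∑ y, ν y * g x y ^ 2 ≤
      c * ∑ y, ν y * f (x, y) ^ 2 + (1 - c) * (∑ y, ν y * f (x, y)) ^ 2 :=
    fun x => hR fun y => f (x, y)
  have hg2 : ∀ y, ∑ x, μ x * g x y = R.mulVec (fun y => ∑ x, μ x * f (x, y)) y := by
    intro y
    simp only [Matrix.mulVec, dotProduct, hg, Finset.mul_sum]
    rw [Finset.sum_comm]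
    exact Finset.sum_congr rfl fun _ _ => Finset.sum_congr rfl fun _ _ => by ring
  have hg3 := hR fun y => ∑ x, μ x * f (x, y)
  simp only [Fintype.sum_prod_type, hQf]
  have swap : ∑ y, ν y * (∑ x, μ x * f (x, y)) = ∑ x, μ x * ∑ y, ν y * f (x, y) := by
    simp only [Finset.mul_sum]
    rw [Finset.sum_comm]
    exact Finset.sum_congr rfl fun _ _ => Finset.sum_congr rfl fun _ _ => by ring
  have key := interaction_nonneg μ ν hμ hν hμ1 hν1 fun x y => f (x, y)
  have hmean : ∑ x, ∑ y, μ x * ν y * f (x, y) = ∑ x, μ x * ∑ y, ν y * f (x, y) := by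
    simp only [Finset.mul_sum, mul_assoc]
  have hsq : ∑ x, ∑ y, μ x * ν y * f (x, y) ^ 2 = ∑ x, μ x * ∑ y, ν y * f (x, y) ^ 2 := by
    simp only [Finset.mul_sum, mul_assoc]
  calc ∑ x, ∑ y, μ x * ν y * (Q.mulVec (fun x' => g x' y) x) ^ 2
      = ∑ y, ν y * ∑ x, μ x * (Q.mulVec (fun x' => g x' y) x) ^ 2 := by
        rw [Finset.sum_comm]
        simp only [Finset.mul_sum]
        exact Finset.sum_congr rfl fun _ _ => Finset.sum_congr rfl fun _ _ => by ring
    _ ≤ ∑ y, ν y * (c * ∑ x, μ x * g x y ^ 2 + (1 - c) * (∑ x, μ x * g x y) ^ 2) :=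
        Finset.sum_le_sum fun y _ => mul_le_mul_of_nonneg_left (hQ fun x => g x y) (hν y)
    _ = c * ∑ x, μ x * ∑ y, ν y * g x y ^ 2
          + (1 - c) * ∑ y, ν y * (R.mulVec (fun y => ∑ x, μ x * f (x, y)) y) ^ 2 := by
        simp only [hg2, mul_add, Finset.sum_add_distrib, Finset.mul_sum]
        congr 1
        · rw [Finset.sum_comm]
          exact Finset.sum_congr rfl fun _ _ => Finset.sum_congr rfl fun _ _ => by ring
        · exact Finset.sum_congr rfl fun _ _ => by ring
    _ ≤ c * ∑ x, μ x * (c * ∑ y, ν y * f (x, y) ^ 2 + (1 - c) * (∑ y, ν y * f (x, y)) ^ 2)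
          + (1 - c) * (c * ∑ y, ν y * (∑ x, μ x * f (x, y)) ^ 2
            + (1 - c) * (∑ y, ν y * ∑ x, μ x * f (x, y)) ^ 2) :=
        add_le_add (mul_le_mul_of_nonneg_left (Finset.sum_le_sum fun x _ =>
          mul_le_mul_of_nonneg_left (hg1 x) (hμ x)) hc0)
          (mul_le_mul_of_nonneg_left hg3 (by linarith))
    _ = c * (c * ∑ x, ∑ y, μ x * ν y * f (x, y) ^ 2
            + (1 - c) * ∑ x, μ x * (∑ y, ν y * f (x, y)) ^ 2)
          + (1 - c) * (c * ∑ y, ν y * (∑ x, μ x * f (x, y)) ^ 2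
            + (1 - c) * (∑ x, μ x * ∑ y, ν y * f (x, y)) ^ 2) := by
        rw [swap, hsq]
        congr 2
        rw [Finset.mul_sum, Finset.mul_sum, ← Finset.sum_add_distrib]
        exact Finset.sum_congr rfl fun _ _ => by ring
    _ ≤ c * ∑ x, ∑ y, μ x * ν y * f (x, y) ^ 2
          + (1 - c) * (∑ x, ∑ y, μ x * ν y * f (x, y)) ^ 2 := by
        rw [hmean]
        nlinarith [mul_le_mul_of_nonneg_left key (mul_nonneg hc0 (sub_nonneg.2 hc1))]

lemma sum_prod_pi_eq_one {ι V : Type*} [Fintype ι] [Fintype V] [DecidableEq ι]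
    (w : ι → V → ℝ) (hw : ∀ i, ∑ v, w i v = 1) : ∑ x : ι → V, ∏ i, w i (x i) = 1 := by
  rw [← Fintype.prod_sum]
  simp [hw]

/-- The contraction factor of `k` independent copies of a chain is that of a single copy. -/
lemma L2Contracts.pi {V : Type*} [Fintype V] {μ : V → ℝ} {Q : Matrix V V ℝ} {c : ℝ}
    (hc0 : 0 ≤ c) (hc1 : c ≤ 1) (hμ : ∀ x, 0 ≤ μ x) (hμ1 : ∑ x, μ x = 1)
    (hQ : L2Contracts μ Q c) (k : ℕ) :
    L2Contracts (fun x : Fin k → V => ∏ i, μ (x i)) (fun x y => ∏ i, Q (x i) (y i)) c := by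
  induction k with
  | zero =>
    intro f
    simp only [Matrix.mulVec, dotProduct, Fintype.sum_unique, Fin.prod_univ_zero, one_mul]
    linarith
  | succ k ih =>
    have h := L2Contracts.prod hc0 hc1 hμ (fun x => Finset.prod_nonneg fun i _ => hμ (x i)) hμ1
      (sum_prod_pi_eq_one (fun (_ : Fin k) => μ) fun _ => hμ1) hQ ih
    intro f
    have h' := h fun z => f (Fin.cons z.1 z.2)
    let e := Fin.consEquiv (fun _ : Fin (k + 1) => V)
    simp only [← e.sum_comp, Matrix.mulVec, dotProduct] at h' ⊢
    simpa [e, Fin.consEquiv, Fin.prod_univ_succ] using h'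

/-! ### Survival outside a set -/

/-- The square norm decays geometrically along a chain killed outside `A`, by the factor
`1 - (1 - c) q`, where `q` is the mass of the complement of `A`. -/
lemma killed_sq_le {X : Type*} [Fintype X] {μ : X → ℝ} {Q : Matrix X X ℝ} {c q : ℝ}
    (hc1 : c ≤ 1) (hμ : ∀ x, 0 ≤ μ x) (hQ : L2Contracts μ Q c)
    (A : X → Prop) [DecidablePred A] (hA : ∑ x, μ x * (if A x then 1 else 0) = 1 - q)
    (hcq : (1 - c) * q ≤ 1)
    (r : ℕ → X → ℝ) (hr0 : ∀ t x, 0 ≤ r t x) (hrA : ∀ t x, ¬ A x → r t x = 0)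
    (hinit : ∑ x, μ x * r 0 x ^ 2 ≤ 1) (hstep : ∀ t x, r (t + 1) x ≤ (Q.mulVec (r t)) x) (t : ℕ) :
    ∑ x, μ x * r t x ^ 2 ≤ (1 - (1 - c) * q) ^ t := by
  induction t with
  | zero => simpa using hinit
  | succ t ih =>
    -- Cauchy–Schwarz on the set `A`, which carries `r t`
    have hcs : (∑ x, μ x * r t x) ^ 2 ≤ (1 - q) * ∑ x, μ x * r t x ^ 2 := by
      have h := Finset.sum_mul_sq_le_sq_mul_sq Finset.univ
        (fun x => Real.sqrt (μ x) * (if A x then 1 else 0)) (fun x => Real.sqrt (μ x) * r t x)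
      have e1 : ∀ x, Real.sqrt (μ x) * (if A x then 1 else 0) * (Real.sqrt (μ x) * r t x) =
          μ x * r t x := by
        intro x
        by_cases hx : A x
        · rw [if_pos hx, mul_one, ← mul_assoc, Real.mul_self_sqrt (hμ x)]
        · simp [hrA t x hx]
      have e2 : ∀ x, (Real.sqrt (μ x) * (if A x then 1 else 0)) ^ 2 =
          μ x * (if A x then 1 else 0) := by
        intro x
        rw [mul_pow, Real.sq_sqrt (hμ x)]
        split_ifs <;> simp
      simp only [e1, e2, mul_pow, Real.sq_sqrt (hμ _)] at h
      rwa [hA] at h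
    calc ∑ x, μ x * r (t + 1) x ^ 2 ≤ ∑ x, μ x * (Q.mulVec (r t)) x ^ 2 :=
          Finset.sum_le_sum fun x _ => mul_le_mul_of_nonneg_left
            (pow_le_pow_left₀ (hr0 _ _) (hstep t x) 2) (hμ x)
      _ ≤ c * ∑ x, μ x * r t x ^ 2 + (1 - c) * (∑ x, μ x * r t x) ^ 2 := hQ _
      _ ≤ c * ∑ x, μ x * r t x ^ 2 + (1 - c) * ((1 - q) * ∑ x, μ x * r t x ^ 2) := by
          gcongr
      _ = (∑ x, μ x * r t x ^ 2) * (1 - (1 - c) * q) := by ring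
      _ ≤ (1 - (1 - c) * q) ^ t * (1 - (1 - c) * q) :=
          mul_le_mul_of_nonneg_right ih (by linarith)
      _ = _ := (pow_succ _ _).symm

/-- Pointwise convergence to the mean, at the rate `c ^ s` in mean square. -/
lemma mixing_sq_le {X : Type*} [Fintype X] [DecidableEq X] {μ : X → ℝ} {Q : Matrix X X ℝ} {c : ℝ}
    (hc0 : 0 ≤ c) (hμ : ∀ x, 0 ≤ μ x) (hμ1 : ∑ x, μ x = 1) (hQ : L2Contracts μ Q c)
    (hQ1 : ∀ x, ∑ y, Q x y = 1) (hstat : ∀ y, ∑ x, μ x * Q x y = μ y)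
    (f : X → ℝ) (s : ℕ) (x : X) :
    μ x * (((Q ^ s).mulVec f) x - ∑ y, μ y * f y) ^ 2 ≤ c ^ s * ∑ y, μ y * f y ^ 2 := by
  have hmean : ∀ g : X → ℝ, ∑ x, μ x * (Q.mulVec g) x = ∑ x, μ x * g x := by
    intro g
    simp only [Matrix.mulVec, dotProduct, Finset.mul_sum]
    rw [Finset.sum_comm]
    refine Finset.sum_congr rfl fun y _ => ?_
    rw [← hstat y, Finset.sum_mul]
    exact Finset.sum_congr rfl fun _ _ => by ring
  have hnorm : ∀ s : ℕ, (∑ x, μ x * ((Q ^ s).mulVec f) x = ∑ y, μ y * f y) ∧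
      ∑ x, μ x * (((Q ^ s).mulVec f) x - ∑ y, μ y * f y) ^ 2 ≤ c ^ s * ∑ y, μ y * f y ^ 2 := by
    intro s
    set m := ∑ y, μ y * f y with hm
    induction s with
    | zero =>
      simp only [pow_zero, Matrix.one_mulVec, one_mul]
      refine ⟨hm.symm, ?_⟩
      have e : ∀ x, μ x * (f x - m) ^ 2 = μ x * f x ^ 2 - 2 * m * (μ x * f x) + m ^ 2 * μ x :=
        fun x => by ring
      simp only [e, Finset.sum_add_distrib, Finset.sum_sub_distrib, ← Finset.mul_sum]
      rw [hμ1, ← hm]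
      nlinarith [sq_nonneg m]
    | succ s ih =>
      have hps : (Q ^ (s + 1)).mulVec f = Q.mulVec ((Q ^ s).mulVec f) := by
        rw [pow_succ', Matrix.mulVec_mulVec]
      refine ⟨by rw [hps, hmean, ih.1], ?_⟩
      have hsub : ∀ x, ((Q ^ (s + 1)).mulVec f) x - m =
          Q.mulVec (fun y => ((Q ^ s).mulVec f) y - m) x := by
        intro x
        rw [hps]
        simp only [Matrix.mulVec, dotProduct, mul_sub, Finset.sum_sub_distrib, ← Finset.sum_mul,
          hQ1, one_mul]
      have hz : ∑ x, μ x * (((Q ^ s).mulVec f) x - m) = 0 := by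
        simp only [mul_sub, Finset.sum_sub_distrib, ← Finset.sum_mul, ih.1, hμ1]
        ring
      have h := hQ fun y => ((Q ^ s).mulVec f) y - m
      simp only [hz, ← hsub] at h
      calc _ ≤ _ := h
        _ = c * ∑ x, μ x * (((Q ^ s).mulVec f) x - m) ^ 2 := by ring
        _ ≤ c * (c ^ s * ∑ y, μ y * f y ^ 2) := mul_le_mul_of_nonneg_left ih.2 hc0
        _ = _ := by ring
  exact (Finset.single_le_sum (f := fun x => μ x * (((Q ^ s).mulVec f) x - ∑ y, μ y * f y) ^ 2)
    (fun y _ => mul_nonneg (hμ y) (sq_nonneg _)) (Finset.mem_univ x)).trans (hnorm s).2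

/-- A chain killed outside `A` is first run for `s` steps to mix and then for `t` steps from near
stationarity. -/
lemma killed_le {X : Type*} [Fintype X] [DecidableEq X] {μ : X → ℝ} {Q : Matrix X X ℝ} {c q : ℝ}
    (hc0 : 0 ≤ c) (hc1 : c ≤ 1) (hμ : ∀ x, 0 < μ x) (hμ1 : ∑ x, μ x = 1)
    (hQ : L2Contracts μ Q c) (hQ0 : ∀ x y, 0 ≤ Q x y)
    (hQ1 : ∀ x, ∑ y, Q x y = 1) (hstat : ∀ y, ∑ x, μ x * Q x y = μ y)
    (A : X → Prop) [DecidablePred A] (hA : ∑ x, μ x * (if A x then 1 else 0) = 1 - q)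
    (hq0 : 0 ≤ q) (hq : q ≤ 1)
    (r : ℕ → X → ℝ) (hr0 : ∀ t x, 0 ≤ r t x) (hrA : ∀ t x, ¬ A x → r t x = 0)
    (hinit : ∑ x, μ x * r 0 x ^ 2 ≤ 1) (hstep : ∀ t x, r (t + 1) x ≤ (Q.mulVec (r t)) x)
    (s t : ℕ) (x : X) :
    r (t + s) x ≤ Real.sqrt ((1 - (1 - c) * q) ^ t) + Real.sqrt (c ^ s / μ x) := by
  have hμ' : ∀ x, 0 ≤ μ x := fun x => (hμ x).le
  have hcq : (1 - c) * q ≤ 1 := by nlinarith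
  have hnorm := killed_sq_le hc1 hμ' hQ A hA hcq r hr0 hrA hinit hstep t
  have hN1 : ∑ x, μ x * r t x ^ 2 ≤ 1 :=
    hnorm.trans (pow_le_one₀ (by linarith) (by nlinarith))
  have hmix := mixing_sq_le hc0 hμ' hμ1 hQ hQ1 hstat (r t) s x
  set m := ∑ y, μ y * r t y with hm
  have hmono : ∀ s x, r (t + s) x ≤ ((Q ^ s).mulVec (r t)) x := by
    intro s
    induction s with
    | zero => intro x; simp
    | succ s ih =>
      intro x
      rw [pow_succ', ← Matrix.mulVec_mulVec]
      exact (hstep (t + s) x).trans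
        (Finset.sum_le_sum fun y _ => mul_le_mul_of_nonneg_left (ih y) (hQ0 x y))
  have hmle : m ≤ Real.sqrt ((1 - (1 - c) * q) ^ t) := by
    refine Real.le_sqrt_of_sq_le (le_trans ?_ hnorm)
    have h0 : 0 ≤ ∑ x, μ x * (r t x - m) ^ 2 :=
      Finset.sum_nonneg fun x _ => mul_nonneg (hμ' x) (sq_nonneg _)
    have e : ∀ x, μ x * (r t x - m) ^ 2 = μ x * r t x ^ 2 - 2 * m * (μ x * r t x) + m ^ 2 * μ x :=
      fun x => by ring
    simp only [e, Finset.sum_add_distrib, Finset.sum_sub_distrib, ← Finset.mul_sum] at h0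
    rw [hμ1, ← hm] at h0
    nlinarith
  have hdev : ((Q ^ s).mulVec (r t)) x - m ≤ Real.sqrt (c ^ s / μ x) := by
    refine Real.le_sqrt_of_sq_le ?_
    rw [le_div_iff₀ (hμ x), mul_comm]
    refine hmix.trans ?_
    simpa using mul_le_mul_of_nonneg_left hN1 (pow_nonneg hc0 s)
  linarith [hmono s x]

/-! ### Collisions in an independent sample -/

lemma sum_prod_pi_succ {V : Type*} [Fintype V] (w : V → ℝ) (h : ℕ) (F : (Fin (h + 1) → V) → ℝ) :
    ∑ x : Fin (h + 1) → V, (∏ i, w (x i)) * F x =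
      ∑ v, w v * ∑ x : Fin h → V, (∏ i, w (x i)) * F (Fin.cons v x) := by
  let e := Fin.consEquiv (fun _ : Fin (h + 1) => V)
  rw [← e.sum_comp, Fintype.sum_prod_type]
  refine Finset.sum_congr rfl fun v _ => ?_
  rw [Finset.mul_sum]
  refine Finset.sum_congr rfl fun x _ => ?_
  simp [e, Fin.consEquiv, Fin.prod_univ_succ, mul_assoc]

lemma sum_prod_pi_const {V : Type*} [Fintype V] (w : V → ℝ) (hw : ∑ v, w v = 1) (h : ℕ) :
    ∑ x : Fin h → V, ∏ i, w (x i) = 1 :=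
  sum_prod_pi_eq_one (fun (_ : Fin h) => w) fun _ => hw

/-- First moment of a sum of independent identically distributed terms. -/
lemma iid_sum_mean {V : Type*} [Fintype V] (w : V → ℝ) (hw : ∑ v, w v = 1) (F : V → ℝ) (h : ℕ) :
    ∑ x : Fin h → V, (∏ i, w (x i)) * ∑ i, F (x i) = h * ∑ v, w v * F v := by
  induction h with
  | zero => simp
  | succ h ih =>
    rw [sum_prod_pi_succ]
    simp only [Fin.sum_univ_succ, Fin.cons_zero, Fin.cons_succ, mul_add, Finset.sum_add_distrib, ih,
      ← Finset.sum_mul, sum_prod_pi_const w hw, one_mul, hw]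
    push_cast
    ring

/-- Second moment of a sum of independent identically distributed terms. -/
lemma iid_sum_second_moment {V : Type*} [Fintype V] (w : V → ℝ) (hw : ∑ v, w v = 1)
    (F : V → ℝ) (h : ℕ) :
    ∑ x : Fin h → V, (∏ i, w (x i)) * (∑ i, F (x i)) ^ 2 =
      h * ∑ v, w v * F v ^ 2 + h * (h - 1) * (∑ v, w v * F v) ^ 2 := by
  induction h with
  | zero => simp
  | succ h ih =>
    rw [sum_prod_pi_succ]
    have e : ∀ v, ∑ x : Fin h → V, (∏ i, w (x i)) *
        (∑ i, F ((Fin.cons v x : Fin (h + 1) → V) i)) ^ 2 =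
        F v ^ 2 + 2 * F v * (h * ∑ v, w v * F v) +
        (h * ∑ v, w v * F v ^ 2 + h * (h - 1) * (∑ v, w v * F v) ^ 2) := by
      intro v
      rw [← ih, ← iid_sum_mean w hw F h]
      simp only [Fin.sum_univ_succ, Fin.cons_zero, Fin.cons_succ, add_sq, mul_add,
        Finset.sum_add_distrib, ← Finset.sum_mul, sum_prod_pi_const w hw, one_mul]
      congr 2
      rw [Finset.mul_sum]
      exact Finset.sum_congr rfl fun _ _ => by ring
    simp only [e, mul_add, Finset.sum_add_distrib, ← Finset.sum_mul, hw]
    have e2 : ∑ v, w v * (2 * F v * (h * ∑ v, w v * F v)) = 2 * h * (∑ v, w v * F v) ^ 2 := by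
      rw [pow_two, ← mul_assoc, Finset.mul_sum (a := 2 * (h : ℝ)), Finset.sum_mul]
      exact Finset.sum_congr rfl fun _ _ => by ring
    rw [e2]
    push_cast
    ring

lemma iid_sum_second_moment_le {V : Type*} [Fintype V] (w : V → ℝ) (hw : ∑ v, w v = 1)
    (F : V → ℝ) (h : ℕ) :
    ∑ x : Fin h → V, (∏ i, w (x i)) * (∑ i, F (x i)) ^ 2 ≤
      h * ∑ v, w v * F v ^ 2 + h ^ 2 * (∑ v, w v * F v) ^ 2 := by
  rw [iid_sum_second_moment w hw]
  nlinarith [mul_nonneg (Nat.cast_nonneg h : (0 : ℝ) ≤ h) (sq_nonneg (∑ v, w v * F v))]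

/-- The probability that `2h` independent samples from `w` are not distinct is at least
`m / (2 (1 + m))`, where `m = h² ∑ w²`. This is the second moment method for the number of
coincidences between the first `h` and the last `h` samples, whose mean is `m`. -/
lemma collision_lower_bound {V : Type*} [Fintype V] [DecidableEq V] (w : V → ℝ)
    (hw0 : ∀ v, 0 ≤ w v) (hw : ∑ v, w v = 1) (h : ℕ) (hpos : 0 < (h : ℝ) ^ 2 * ∑ v, w v ^ 2) :
    (h : ℝ) ^ 2 * ∑ v, w v ^ 2 ≤
      2 * (1 + (h : ℝ) ^ 2 * ∑ v, w v ^ 2) * ∑ x : Fin (h + h) → V, (∏ i, w (x i)) *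
        (if Function.Injective x then 0 else 1) := by
  set p := ∑ v, w v ^ 2 with hp
  set m := (h : ℝ) ^ 2 * p with hm
  set q := ∑ x : Fin (h + h) → V, (∏ i, w (x i)) * (if Function.Injective x then (0 : ℝ) else 1)
    with hq
  -- the number of indices `i` with `x i = v`
  let N : (Fin h → V) → V → ℝ := fun x v => ∑ i, if x i = v then 1 else 0
  let Z : (Fin h → V) × (Fin h → V) → ℝ := fun z => ∑ j, N z.1 (z.2 j)
  let W : (Fin h → V) × (Fin h → V) → ℝ := fun z => (∏ i, w (z.1 i)) * ∏ i, w (z.2 i)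
  let c : (Fin h → V) × (Fin h → V) → ℝ := fun z =>
    if Function.Injective (Fin.append z.1 z.2) then 0 else 1
  have hW0 : ∀ z, 0 ≤ W z := fun z =>
    mul_nonneg (Finset.prod_nonneg fun _ _ => hw0 _) (Finset.prod_nonneg fun _ _ => hw0 _)
  have hqW : q = ∑ z, W z * c z := by
    rw [hq, ← (Fin.appendEquiv h h).sum_comp]
    refine Finset.sum_congr rfl fun z _ => ?_
    simp only [W, c, Fin.appendEquiv, Equiv.coe_fn_mk, Fin.prod_univ_add, Fin.append_left,
      Fin.append_right]
    congr
  have hZc : ∀ z, Z z = c z * Z z := by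
    intro z
    by_cases hz : Function.Injective (Fin.append z.1 z.2)
    · have : ∀ i j, z.1 i ≠ z.2 j := by
        intro i j hij
        have := @hz (Fin.castAdd h i) (Fin.natAdd h j) (by rwa [Fin.append_left, Fin.append_right])
        have := congrArg Fin.val this
        simp at this
        omega
      simp [Z, N, this]
    · simp [c, hz]
  have hcc : ∀ z, c z ^ 2 = c z := fun z => by simp only [c]; split_ifs <;> simp
  have hcs : (∑ z, W z * Z z) ^ 2 ≤ q * ∑ z, W z * Z z ^ 2 := by
    have h' := Finset.sum_mul_sq_le_sq_mul_sq Finset.univ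
      (fun z => Real.sqrt (W z) * c z) (fun z => Real.sqrt (W z) * Z z)
    have e1 : ∀ z, Real.sqrt (W z) * c z * (Real.sqrt (W z) * Z z) = W z * Z z := by
      intro z
      conv_rhs => rw [hZc z, ← Real.mul_self_sqrt (hW0 z)]
      ring
    simp only [e1, mul_pow, Real.sq_sqrt (hW0 _), hcc, ← hqW] at h'
    exact h'
  have hwN : ∀ x, ∑ v, w v * N x v = ∑ i, w (x i) := by
    intro x
    simp only [N, Finset.mul_sum]
    rw [Finset.sum_comm]
    simp
  have hEZ : ∑ z, W z * Z z = m := by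
    rw [Fintype.sum_prod_type]
    have e : ∀ x : Fin h → V, ∑ y, W (x, y) * Z (x, y) =
        (∏ i, w (x i)) * ∑ i, h * w (x i) := by
      intro x
      simp only [W, Z, mul_assoc, ← Finset.mul_sum]
      rw [iid_sum_mean w hw, hwN]
    simp only [e]
    rw [iid_sum_mean w hw (fun v => h * w v), hm, hp, Finset.mul_sum, Finset.mul_sum]
    exact Finset.sum_congr rfl fun _ _ => by ring
  have hEZ2 : ∑ z, W z * Z z ^ 2 ≤ m + 2 * (h : ℝ) ^ 3 * ∑ v, w v ^ 3 + m ^ 2 := by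
    rw [Fintype.sum_prod_type]
    have hw1 : ∀ x : Fin h → V, 0 ≤ ∏ i, w (x i) := fun x => Finset.prod_nonneg fun _ _ => hw0 _
    have e : ∀ x : Fin h → V, ∑ y, W (x, y) * Z (x, y) ^ 2 ≤
        h * ∑ v, w v * ((∏ i, w (x i)) * N x v ^ 2)
          + h ^ 2 * ((∏ i, w (x i)) * (∑ i, w (x i)) ^ 2) := by
      intro x
      simp only [W, Z, mul_assoc, ← Finset.mul_sum]
      have h1 := mul_le_mul_of_nonneg_left (iid_sum_second_moment_le w hw (N x) h) (hw1 x)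
      rw [hwN] at h1
      refine h1.trans (le_of_eq ?_)
      rw [mul_add]
      congr 1
      · simp only [Finset.mul_sum]
        exact Finset.sum_congr rfl fun _ _ => by ring
      · ring
    have h2 : ∀ v, ∑ x : Fin h → V, (∏ i, w (x i)) * N x v ^ 2 ≤ h * w v + h ^ 2 * w v ^ 2 := by
      intro v
      have := iid_sum_second_moment_le w hw (fun u => if u = v then 1 else 0) h
      simpa only [ite_pow, one_pow, zero_pow two_ne_zero, mul_ite, mul_one, mul_zero,
        Finset.sum_ite_eq', Finset.mem_univ, if_true] using this
    have h3 : ∑ x : Fin h → V, (∏ i, w (x i)) * (∑ i, w (x i)) ^ 2 ≤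
        h * ∑ v, w v ^ 3 + h ^ 2 * p ^ 2 := by
      refine (iid_sum_second_moment_le w hw w h).trans (le_of_eq ?_)
      simp only [← pow_succ', ← pow_two, hp]
    calc ∑ x, ∑ y, W (x, y) * Z (x, y) ^ 2
        ≤ ∑ x : Fin h → V, (h * ∑ v, w v * ((∏ i, w (x i)) * N x v ^ 2)
          + h ^ 2 * ((∏ i, w (x i)) * (∑ i, w (x i)) ^ 2)) := Finset.sum_le_sum fun x _ => e x
      _ = h * ∑ v, w v * ∑ x : Fin h → V, (∏ i, w (x i)) * N x v ^ 2
          + h ^ 2 * ∑ x : Fin h → V, (∏ i, w (x i)) * (∑ i, w (x i)) ^ 2 := by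
          rw [Finset.sum_add_distrib, ← Finset.mul_sum, ← Finset.mul_sum, Finset.sum_comm]
          simp only [Finset.mul_sum]
      _ ≤ h * ∑ v, w v * (h * w v + h ^ 2 * w v ^ 2)
          + h ^ 2 * (h * ∑ v, w v ^ 3 + h ^ 2 * p ^ 2) := by
          gcongr with v _
          · exact hw0 v
          · exact h2 v
      _ = m + 2 * (h : ℝ) ^ 3 * ∑ v, w v ^ 3 + m ^ 2 := by
          have e4 : ∑ v, w v * (h * w v + h ^ 2 * w v ^ 2) = h * p + h ^ 2 * ∑ v, w v ^ 3 := by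
            rw [hp, Finset.mul_sum, Finset.mul_sum, ← Finset.sum_add_distrib]
            exact Finset.sum_congr rfl fun _ _ => by ring
          rw [e4, hm]
          ring
  -- the triple coincidences are dominated by `2 a³ ≤ a² + a⁴` at `a = h * w v`
  have h3 : 2 * (h : ℝ) ^ 3 * ∑ v, w v ^ 3 ≤ m + m ^ 2 := by
    have e1 : 2 * (h : ℝ) ^ 3 * ∑ v, w v ^ 3 ≤ ∑ v, (h * w v) ^ 2 + ∑ v, ((h * w v) ^ 2) ^ 2 := by
      rw [Finset.mul_sum, ← Finset.sum_add_distrib]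
      refine Finset.sum_le_sum fun v _ => ?_
      nlinarith [sq_nonneg ((h * w v) ^ 2 - h * w v)]
    have e2 : ∑ v, ((h * w v) ^ 2) ^ 2 ≤ (∑ v, (h * w v) ^ 2) ^ 2 :=
      Finset.sum_sq_le_sq_sum_of_nonneg fun v _ => sq_nonneg _
    have e3 : ∑ v, ((h : ℝ) * w v) ^ 2 = m := by simp only [mul_pow, ← Finset.mul_sum, hm, hp]
    rw [e3] at e1 e2
    linarith
  have hq0 : 0 ≤ q := by
    rw [hqW]
    refine Finset.sum_nonneg fun z _ => mul_nonneg (hW0 z) ?_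
    simp only [c]; split_ifs <;> simp
  rw [hEZ] at hcs
  have h5 : m * m ≤ m * (2 * (1 + m) * q) := by
    calc m * m = m ^ 2 := by ring
      _ ≤ q * ∑ z, W z * Z z ^ 2 := hcs
      _ ≤ q * (2 * (m + m ^ 2)) := by gcongr; linarith
      _ = _ := by ring
  exact le_of_mul_le_mul_left h5 hpos

/-! ### The spectral gap of a reversible chain -/

/-- For a reversible transition matrix whose quadratic form lies between `0` and the identity and
attains the upper bound only at constants, the second largest eigenvalue `l` satisfies `0 ≤ l < 1`,
and the chain contracts in mean square by the factor `l²`. -/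
lemma l2Contracts_of_reversible {V : Type*} [Fintype V] [DecidableEq V] (π : V → ℝ)
    (P : Matrix V V ℝ) (hπ : ∀ v, 0 < π v) (hπ1 : ∑ v, π v = 1) (hP1 : ∀ v, ∑ w, P v w = 1)
    (hrev : ∀ v w, π v * P v w = π w * P w v)
    (h0 : ∀ f : V → ℝ, 0 ≤ ∑ v, π v * (f v * P.mulVec f v))
    (h1 : ∀ f : V → ℝ, ∑ v, π v * (f v * P.mulVec f v) ≤ ∑ v, π v * f v ^ 2)
    (h2 : ∀ f : V → ℝ, ∑ v, π v * (f v * P.mulVec f v) = ∑ v, π v * f v ^ 2 →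
      ∀ v w, f v = f w)
    (hcard : 2 ≤ Fintype.card V) (l : ℝ) (hl : l = (P.charpoly.roots.sort (· ≥ ·)).getD 1 0) :
    0 ≤ l ∧ l < 1 ∧ L2Contracts π P (l ^ 2) := by
  have hs : ∀ v, 0 < Real.sqrt (π v) := fun v => Real.sqrt_pos.2 (hπ v)
  have hss : ∀ v, Real.sqrt (π v) * Real.sqrt (π v) = π v := fun v => Real.mul_self_sqrt (hπ v).le
  -- the symmetric matrix similar to `P`
  let A : Matrix V V ℝ := Matrix.of fun v w => Real.sqrt (π v) * P v w * (Real.sqrt (π w))⁻¹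
  have hA : A.IsHermitian := by
    ext v w
    simp only [A, Matrix.conjTranspose_apply, Matrix.of_apply, star_trivial]
    have := hrev v w
    have hv := (hs v).ne'
    have hw := (hs w).ne'
    field_simp
    rw [pow_two, pow_two, hss, hss]
    linarith
  have hchar : A.charpoly = P.charpoly := by
    let D : Matrix V V ℝ := Matrix.diagonal fun v => Real.sqrt (π v)
    let D' : Matrix V V ℝ := Matrix.diagonal fun v => (Real.sqrt (π v))⁻¹
    have hD : D * D' = 1 := by
      rw [Matrix.diagonal_mul_diagonal, ← Matrix.diagonal_one]
      congr 1
      ext v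
      exact mul_inv_cancel₀ (hs v).ne'
    have hD' : D' * D = 1 := by
      rw [Matrix.diagonal_mul_diagonal, ← Matrix.diagonal_one]
      congr 1
      ext v
      exact inv_mul_cancel₀ (hs v).ne'
    have := Matrix.charpoly_units_conj ⟨D, D', hD, hD'⟩ P
    rw [← this]
    congr 1
    ext v w
    rw [show (((⟨D, D', hD, hD'⟩ : (Matrix V V ℝ)ˣ) : Matrix V V ℝ))⁻¹ = D' from
      Matrix.inv_eq_right_inv hD]
    simp only [A, D, D', Matrix.mul_diagonal, Matrix.diagonal_mul, Matrix.of_apply]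
  have hl' : l = hA.eigenvalues₀ ⟨1, hcard⟩ := by
    have h := hA.sort_roots_charpoly_eq_eigenvalues₀
    have hre : (RCLike.re : ℝ → ℝ) = id := rfl
    rw [hre, Multiset.map_id, hchar] at h
    rw [hl, h, List.getD_eq_getElem _ _ (by rw [List.length_ofFn]; omega)]
    simp
  -- `i0` carries the largest eigenvalue; all the other eigenvalues are at most `l`
  let e := Fintype.equivOfCardEq (Fintype.card_fin (Fintype.card V))
  let i0 : V := e ⟨0, by omega⟩
  set ev := hA.eigenvalues with hev
  have hev_le0 : ∀ i, ev i ≤ ev i0 := by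
    intro i
    simp only [hev, Matrix.IsHermitian.eigenvalues]
    apply hA.eigenvalues₀_antitone
    simp only [i0, e, Equiv.symm_apply_apply]
    exact Nat.zero_le _
  have hev_le1 : ∀ i, i ≠ i0 → ev i ≤ l := by
    intro i hi
    rw [hl']
    simp only [hev, Matrix.IsHermitian.eigenvalues]
    apply hA.eigenvalues₀_antitone
    change (1 : ℕ) ≤ (e.symm i : ℕ)
    by_contra hlt
    apply hi
    have : e.symm i = ⟨0, by omega⟩ := Fin.ext (by simp only; omega)
    rw [← e.apply_symm_apply i, this]
  have hl_mem : ∃ i, i ≠ i0 ∧ ev i = l := by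
    refine ⟨e ⟨1, hcard⟩, fun h => ?_, ?_⟩
    · have := e.injective h
      simp at this
    · rw [hl']
      simp only [hev, Matrix.IsHermitian.eigenvalues]
      congr 1
      simp [e]
  -- the eigenfunctions of `P`, orthonormal in `L²(π)`
  let φ : V → V → ℝ := fun i v => (Real.sqrt (π v))⁻¹ * hA.eigenvectorBasis i v
  have hφ : ∀ i v, Real.sqrt (π v) * φ i v = hA.eigenvectorBasis i v := fun i v => by
    simp only [φ]
    rw [← mul_assoc, mul_inv_cancel₀ (hs v).ne', one_mul]
  have hPφ : ∀ i v, P.mulVec (φ i) v = ev i * φ i v := by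
    intro i v
    have h := congrFun (hA.mulVec_eigenvectorBasis i) v
    simp only [Matrix.mulVec, dotProduct, A, Matrix.of_apply, Pi.smul_apply, smul_eq_mul] at h
    rw [← hφ i v] at h
    have h' : Real.sqrt (π v) * ∑ w, P v w * φ i w = Real.sqrt (π v) * (ev i * φ i v) := by
      rw [Finset.mul_sum]
      calc _ = ∑ w, Real.sqrt (π v) * P v w * (Real.sqrt (π w))⁻¹ * hA.eigenvectorBasis i w :=
            Finset.sum_congr rfl fun w _ => by simp only [φ]; ring
        _ = _ := by rw [h]; ring
    exact mul_left_cancel₀ (hs v).ne' h'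
  have hcoef : ∀ (f : V → ℝ) i, inner ℝ (hA.eigenvectorBasis i)
      (WithLp.toLp 2 fun v => Real.sqrt (π v) * f v) = ∑ v, π v * (φ i v * f v) := by
    intro f i
    rw [PiLp.inner_apply]
    refine Finset.sum_congr rfl fun v _ => ?_
    rw [← hφ, ← hss v]
    simp
    ring
  have hpars : ∀ f : V → ℝ, ∑ i, (∑ v, π v * (φ i v * f v)) ^ 2 = ∑ v, π v * f v ^ 2 := by
    intro f
    have h := hA.eigenvectorBasis.sum_sq_norm_inner_right
      (WithLp.toLp 2 fun v => Real.sqrt (π v) * f v)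
    simp only [hcoef, Real.norm_eq_abs, sq_abs, EuclideanSpace.norm_sq_eq] at h
    rw [h]
    exact Finset.sum_congr rfl fun v _ => by rw [mul_pow, pow_two (Real.sqrt _), hss]
  have horth : ∀ i j, ∑ v, π v * (φ i v * φ j v) = if i = j then 1 else 0 := by
    intro i j
    rw [← hcoef, ← orthonormal_iff_ite.1 hA.eigenvectorBasis.orthonormal i j]
    congr 1
    ext v
    simp [hφ]
  have hunit : ∀ i, ∑ v, π v * φ i v ^ 2 = 1 := fun i => by
    simpa [pow_two] using horth i i
  have hform : ∀ i, ∑ v, π v * (φ i v * P.mulVec (φ i) v) = ev i := by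
    intro i
    calc _ = ev i * ∑ v, π v * φ i v ^ 2 := by
          rw [Finset.mul_sum]
          exact Finset.sum_congr rfl fun v _ => by rw [hPφ]; ring
      _ = ev i := by rw [hunit, mul_one]
  have hev0 : ∀ i, 0 ≤ ev i := fun i => hform i ▸ h0 (φ i)
  have hev1 : ∀ i, ev i ≤ 1 := fun i => by
    have := h1 (φ i)
    rwa [hform, hunit] at this
  have hconst : ∀ i, ev i = 1 → ∀ v w, φ i v = φ i w := fun i hi =>
    h2 (φ i) (by rw [hform, hunit, hi])
  have hPcoef : ∀ (f : V → ℝ) i, ∑ v, π v * (φ i v * P.mulVec f v) =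
      ev i * ∑ v, π v * (φ i v * f v) := by
    intro f i
    calc ∑ v, π v * (φ i v * P.mulVec f v) = ∑ v, ∑ w, π v * P v w * (φ i v * f w) := by
          simp only [Matrix.mulVec, dotProduct, Finset.mul_sum]
          exact Finset.sum_congr rfl fun _ _ => Finset.sum_congr rfl fun _ _ => by ring
      _ = ∑ w, ∑ v, π w * P w v * (φ i v * f w) := by
          rw [Finset.sum_comm]
          exact Finset.sum_congr rfl fun w _ => Finset.sum_congr rfl fun v _ => by rw [hrev v w]
      _ = ∑ w, π w * (P.mulVec (φ i) w * f w) := by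
          simp only [Matrix.mulVec, dotProduct, Finset.mul_sum, Finset.sum_mul]
          exact Finset.sum_congr rfl fun _ _ => Finset.sum_congr rfl fun _ _ => by ring
      _ = _ := by
          rw [Finset.mul_sum]
          exact Finset.sum_congr rfl fun v _ => by rw [hPφ]; ring
  -- the eigenvalue `1` of the constants is the largest one
  have hone : P.mulVec (fun _ => 1) = fun _ => 1 := by
    ext v
    simp [Matrix.mulVec, dotProduct, hP1]
  have hi0 : ev i0 = 1 := by
    have hex : ∃ i, ∑ v, π v * (φ i v * 1) ≠ 0 := by
      by_contra hall
      push Not at hall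
      have := hpars fun _ => 1
      simp only [hall] at this
      simp [hπ1] at this
    obtain ⟨i, hi⟩ := hex
    have := hPcoef (fun _ => 1) i
    rw [hone] at this
    have hi1 : ev i = 1 := by
      have h' : (ev i - 1) * ∑ v, π v * (φ i v * 1) = 0 := by linarith
      rcases mul_eq_zero.1 h' with h' | h'
      · linarith
      · exact absurd h' hi
    exact le_antisymm (hev1 i0) (hi1 ▸ hev_le0 i)
  obtain ⟨i1, hi1ne, hi1⟩ := hl_mem
  have hl0 : 0 ≤ l := hi1 ▸ hev0 i1
  have hφ0 := hconst i0 hi0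
  have hcsq : ∀ f : V → ℝ, (∑ v, π v * (φ i0 v * f v)) ^ 2 = (∑ v, π v * f v) ^ 2 := by
    intro f
    have hc : φ i0 i0 ^ 2 = 1 := by
      have := hunit i0
      rw [Finset.sum_congr rfl fun v _ => by rw [hφ0 v i0]] at this
      rwa [← Finset.sum_mul, hπ1, one_mul] at this
    have : ∑ v, π v * (φ i0 v * f v) = φ i0 i0 * ∑ v, π v * f v := by
      rw [Finset.mul_sum]
      exact Finset.sum_congr rfl fun v _ => by rw [hφ0 v i0]; ring
    rw [this, mul_pow, hc, one_mul]
  refine ⟨hl0, lt_of_le_of_ne (hi1 ▸ hev1 i1) fun hl1 => ?_, fun f => ?_⟩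
  · -- two constant eigenvectors cannot be orthogonal
    have hcon := hconst i1 (by rw [hi1, hl1])
    have h := hcsq (φ i1)
    rw [horth, if_neg hi1ne.symm] at h
    have hsum : ∑ v, π v * φ i1 v = φ i1 i0 := by
      rw [Finset.sum_congr rfl fun v _ => by rw [hcon v i0], ← Finset.sum_mul, hπ1, one_mul]
    have hz : φ i1 i0 = 0 := by
      rw [hsum] at h
      exact pow_eq_zero_iff (two_ne_zero) |>.1 (by rw [← h]; norm_num)
    have := hunit i1
    rw [Finset.sum_congr rfl fun v _ => by rw [hcon v i0, hz]] at this
    simp at this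
  · rw [← hpars (P.mulVec f), ← hpars f, ← hcsq f]
    simp only [hPcoef]
    rw [← Finset.add_sum_erase _ _ (Finset.mem_univ i0),
      ← Finset.add_sum_erase _ (fun i => (∑ v, π v * (φ i v * f v)) ^ 2) (Finset.mem_univ i0),
      hi0, one_mul, mul_add, Finset.mul_sum]
    have : ∑ i ∈ Finset.univ.erase i0, (ev i * ∑ v, π v * (φ i v * f v)) ^ 2 ≤
        ∑ i ∈ Finset.univ.erase i0, l ^ 2 * (∑ v, π v * (φ i v * f v)) ^ 2 := by
      refine Finset.sum_le_sum fun i hi => ?_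
      rw [mul_pow]
      exact mul_le_mul_of_nonneg_right
        (pow_le_pow_left₀ (hev0 i) (hev_le1 i (Finset.ne_of_mem_erase hi)) 2) (sq_nonneg _)
    rw [← Finset.mul_sum] at this ⊢
    linarith

/-! ### The lazy random walk on a connected graph -/

lemma eq_of_adj_eq {V : Type*} {G : SimpleGraph V} (hG : G.Connected) (f : V → ℝ)
    (hf : ∀ v w, G.Adj v w → f v = f w) (v w : V) :
    f v = f w := by
  obtain ⟨p⟩ := hG.preconnected v w
  induction p with
  | nil => rfl
  | cons h _ ih => exact (hf _ _ h).trans ih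

section LazyWalk

variable {V : Type*} [Fintype V] (G : SimpleGraph V) [DecidableRel G.Adj]

/-- The stationary distribution `d(v) / 2m` of the random walk on `G`. -/
def stationary (v : V) : ℝ := G.degree v / (2 * G.edgeFinset.card)

lemma lazyMatrix_nonneg (v w : V) : 0 ≤ lazyMatrix G v w := ENNReal.toReal_nonneg

lemma sum_lazyMatrix (v : V) : ∑ w, lazyMatrix G v w = 1 := by
  have h := (lazyStep G v).tsum_coe
  rw [tsum_fintype] at h
  simp only [lazyMatrix, Matrix.of_apply]
  rw [← ENNReal.toReal_sum fun w _ => (lazyStep G v).apply_ne_top w, h, ENNReal.toReal_one]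

variable {G} in
lemma lazyMatrix_apply [DecidableEq V] {v : V} (hv : 0 < G.degree v) (w : V) :
    lazyMatrix G v w = (if w = v then 2⁻¹ else 0) +
      (if G.Adj v w then 2⁻¹ * (G.degree v : ℝ)⁻¹ else 0) := by
  have hne : (G.neighborFinset v).Nonempty := by
    rwa [← Finset.card_pos, SimpleGraph.card_neighborFinset_eq_degree]
  simp only [lazyMatrix, Matrix.of_apply, lazyStep, PMF.bind_apply, tsum_fintype,
    Fintype.sum_bool, PMF.uniformOfFintype_apply, Fintype.card_bool, if_true, PMF.pure_apply,
    dif_pos hne, Bool.false_eq_true, if_false, PMF.uniformOfFinset_apply,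
    SimpleGraph.mem_neighborFinset, SimpleGraph.card_neighborFinset_eq_degree]
  have hd : (G.degree v : ℝ≥0∞) ≠ 0 := by exact_mod_cast hv.ne'
  split_ifs
  · rw [ENNReal.toReal_add (by simp) (ENNReal.mul_ne_top (by simp) (by simpa using hd))]
    simp
  all_goals simp

variable {G}

lemma degree_pos_of_connected (hG : G.Connected) (hn : 2 ≤ Fintype.card V) (v : V) :
    0 < G.degree v := by
  have : Nontrivial V := Fintype.one_lt_card_iff_nontrivial.1 (by omega)
  exact hG.preconnected.degree_pos_of_nontrivial v

lemma sum_degree_cast : ∑ v, (G.degree v : ℝ) = 2 * G.edgeFinset.card := by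
  exact_mod_cast G.sum_degrees_eq_twice_card_edges

lemma two_mul_card_edges_pos (hG : G.Connected) (hn : 2 ≤ Fintype.card V) :
    (0 : ℝ) < 2 * G.edgeFinset.card := by
  rw [← sum_degree_cast]
  have := hG.nonempty
  exact Finset.sum_pos (fun v _ => by exact_mod_cast degree_pos_of_connected hG hn v)
    Finset.univ_nonempty

lemma stationary_pos (hG : G.Connected) (hn : 2 ≤ Fintype.card V) (v : V) : 0 < stationary G v :=
  div_pos (by exact_mod_cast degree_pos_of_connected hG hn v) (two_mul_card_edges_pos hG hn)

lemma sum_stationary (hG : G.Connected) (hn : 2 ≤ Fintype.card V) : ∑ v, stationary G v = 1 := by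
  simp only [stationary]
  rw [← Finset.sum_div, sum_degree_cast, div_self (two_mul_card_edges_pos hG hn).ne']

lemma inv_sq_le_stationary (hG : G.Connected) (hn : 2 ≤ Fintype.card V) (v : V) :
    ((Fintype.card V : ℝ) ^ 2)⁻¹ ≤ stationary G v := by
  have h1 : (1 : ℝ) ≤ G.degree v := by exact_mod_cast degree_pos_of_connected hG hn v
  have h2 : (2 * G.edgeFinset.card : ℝ) ≤ (Fintype.card V : ℝ) ^ 2 := by
    rw [← sum_degree_cast, pow_two, ← Finset.card_univ, ← nsmul_eq_mul]
    exact Finset.sum_le_card_nsmul _ _ _ fun v _ => by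
      exact_mod_cast (G.degree_lt_card_verts v).le
  have h3 := two_mul_card_edges_pos hG hn
  rw [stationary, inv_eq_one_div]
  exact div_le_div₀ (by linarith) h1 h3 h2

/-- For `s = 1` and `s = -1`, the sum of the squares of `f v + s * f w` over the oriented edges. -/
lemma sum_adj_sq (hG : G.Connected) (hn : 2 ≤ Fintype.card V) (f : V → ℝ) (s : ℝ) (hs : s ^ 2 = 1) :
    ∑ v, ∑ w, (if G.Adj v w then (f v + s * f w) ^ 2 else 0) =
      2 * (2 * (G.edgeFinset.card : ℝ)) * ∑ v, stationary G v * f v ^ 2 +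
        2 * s * ∑ v, ∑ w, if G.Adj v w then f v * f w else 0 := by
  have h1 : ∑ v, ∑ w, (if G.Adj v w then f v ^ 2 else 0) =
      2 * (G.edgeFinset.card : ℝ) * ∑ v, stationary G v * f v ^ 2 := by
    rw [Finset.mul_sum]
    refine Finset.sum_congr rfl fun v _ => ?_
    rw [← Finset.sum_filter, Finset.sum_const, nsmul_eq_mul, ← G.neighborFinset_eq_filter,
      G.card_neighborFinset_eq_degree, stationary, ← mul_assoc,
      mul_div_cancel₀ _ (two_mul_card_edges_pos hG hn).ne']
  have h2 : ∑ v, ∑ w, (if G.Adj v w then f w ^ 2 else 0) =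
      2 * (G.edgeFinset.card : ℝ) * ∑ v, stationary G v * f v ^ 2 := by
    rw [← h1, Finset.sum_comm]
    simp only [G.adj_comm]
  have e : ∀ v w, (if G.Adj v w then (f v + s * f w) ^ 2 else 0) =
      (if G.Adj v w then f v ^ 2 else 0) + (if G.Adj v w then f w ^ 2 else 0)
        + 2 * s * (if G.Adj v w then f v * f w else 0) := by
    intro v w
    split_ifs
    · linear_combination f w ^ 2 * hs
    · ring
  simp only [e, Finset.sum_add_distrib, ← Finset.mul_sum, h1, h2]
  ring

variable [DecidableEq V]

lemma card_div_degreeVariability (hn : 2 ≤ Fintype.card V) :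
    (Fintype.card V : ℝ) / degreeVariability G = (∑ v, stationary G v ^ 2)⁻¹ := by
  have hc : (Fintype.card V : ℝ) ≠ 0 := by
    have : Fintype.card V ≠ 0 := by omega
    exact_mod_cast this
  simp only [degreeVariability, stationary, div_pow, ← Finset.sum_div]
  rw [mul_div_assoc, div_mul_cancel_left₀ hc]

lemma stationary_mul_lazyMatrix (hG : G.Connected) (hn : 2 ≤ Fintype.card V) (v w : V) :
    stationary G v * lazyMatrix G v w = (if w = v then stationary G v * 2⁻¹ else 0) +
      (if G.Adj v w then (2 * (2 * (G.edgeFinset.card : ℝ)))⁻¹ else 0) := by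
  have hv := degree_pos_of_connected hG hn v
  have hv' : (G.degree v : ℝ) ≠ 0 := by exact_mod_cast hv.ne'
  have hm := (two_mul_card_edges_pos hG hn).ne'
  rw [lazyMatrix_apply hv, mul_add]
  congr 1
  · split_ifs <;> simp
  · split_ifs
    · rw [stationary]
      field_simp
    · simp

lemma lazyMatrix_reversible (hG : G.Connected) (hn : 2 ≤ Fintype.card V) (v w : V) :
    stationary G v * lazyMatrix G v w = stationary G w * lazyMatrix G w v := by
  rw [stationary_mul_lazyMatrix hG hn, stationary_mul_lazyMatrix hG hn]
  congr 1
  · by_cases h : w = v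
    · simp [h]
    · simp [h, Ne.symm h]
  · simp only [G.adj_comm]

lemma stationary_stationary (hG : G.Connected) (hn : 2 ≤ Fintype.card V) (w : V) :
    ∑ v, stationary G v * lazyMatrix G v w = stationary G w := by
  simp only [lazyMatrix_reversible hG hn _ w, ← Finset.mul_sum, sum_lazyMatrix, mul_one]

/-- The quadratic form is half the square norm plus half the form of the walk that is not lazy. -/
lemma lazyMatrix_quadForm (hG : G.Connected) (hn : 2 ≤ Fintype.card V) (f : V → ℝ) :
    ∑ v, stationary G v * (f v * (lazyMatrix G).mulVec f v) =
      2⁻¹ * ∑ v, stationary G v * f v ^ 2 + (2 * (2 * (G.edgeFinset.card : ℝ)))⁻¹ *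
        ∑ v, ∑ w, if G.Adj v w then f v * f w else 0 := by
  rw [Finset.mul_sum, Finset.mul_sum, ← Finset.sum_add_distrib]
  refine Finset.sum_congr rfl fun v _ => ?_
  calc stationary G v * (f v * (lazyMatrix G).mulVec f v)
      = ∑ w, f v * (stationary G v * lazyMatrix G v w) * f w := by
        simp only [Matrix.mulVec, dotProduct, Finset.mul_sum]
        exact Finset.sum_congr rfl fun _ _ => by ring
    _ = ∑ w, ((if w = v then 2⁻¹ * (stationary G v * f v ^ 2) else 0) +
          (2 * (2 * (G.edgeFinset.card : ℝ)))⁻¹ * if G.Adj v w then f v * f w else 0) := by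
        refine Finset.sum_congr rfl fun w _ => ?_
        rw [stationary_mul_lazyMatrix hG hn, mul_add, add_mul]
        congr 1
        · split_ifs with h
          · rw [h]; ring
          · ring
        · split_ifs <;> ring
    _ = _ := by
        rw [Finset.sum_add_distrib, ← Finset.mul_sum]
        simp

/-- The spectral gap of the lazy walk on a connected graph. -/
theorem lazyMatrix_l2Contracts (hG : G.Connected) (hn : 2 ≤ Fintype.card V) :
    0 ≤ lambdaTwo G ∧ lambdaTwo G < 1 ∧
      L2Contracts (stationary G) (lazyMatrix G) (lambdaTwo G ^ 2) := by
  have hm := two_mul_card_edges_pos hG hn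
  have hpos : ∀ (f : V → ℝ) (s : ℝ),
      0 ≤ ∑ v, ∑ w, (if G.Adj v w then (f v + s * f w) ^ 2 else 0) := fun f s =>
    Finset.sum_nonneg fun v _ => Finset.sum_nonneg fun w _ => by split_ifs <;> positivity
  -- the two halves of the quadratic form as sums of squares over the edges
  have hplus : ∀ f : V → ℝ, ∑ v, stationary G v * (f v * (lazyMatrix G).mulVec f v) =
      (4 * (2 * (G.edgeFinset.card : ℝ)))⁻¹ *
        ∑ v, ∑ w, (if G.Adj v w then (f v + 1 * f w) ^ 2 else 0) := by
    intro f
    rw [lazyMatrix_quadForm hG hn, sum_adj_sq hG hn f 1 (by norm_num)]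
    have hE : (G.edgeFinset.card : ℝ) ≠ 0 := by
      intro h
      simp [h] at hm
    field_simp
    ring
  have hminus : ∀ f : V → ℝ, ∑ v, stationary G v * f v ^ 2 -
      ∑ v, stationary G v * (f v * (lazyMatrix G).mulVec f v) =
      (4 * (2 * (G.edgeFinset.card : ℝ)))⁻¹ *
        ∑ v, ∑ w, (if G.Adj v w then (f v + (-1) * f w) ^ 2 else 0) := by
    intro f
    rw [lazyMatrix_quadForm hG hn, sum_adj_sq hG hn f (-1) (by norm_num)]
    have hE : (G.edgeFinset.card : ℝ) ≠ 0 := by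
      intro h
      simp [h] at hm
    field_simp
    ring
  have hinv : (0 : ℝ) < (4 * (2 * (G.edgeFinset.card : ℝ)))⁻¹ := by positivity
  refine l2Contracts_of_reversible (stationary G) (lazyMatrix G) (stationary_pos hG hn)
    (sum_stationary hG hn) (sum_lazyMatrix G) (lazyMatrix_reversible hG hn) (fun f => ?_)
    (fun f => ?_) (fun f hf => ?_) hn _ rfl
  · rw [hplus]
    exact mul_nonneg hinv.le (hpos f 1)
  · have := mul_nonneg hinv.le (hpos f (-1))
    rw [← hminus] at this
    linarith
  · refine eq_of_adj_eq hG f fun v w hvw => ?_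
    have h := hminus f
    rw [hf, sub_self, eq_comm, mul_eq_zero, or_iff_right hinv.ne',
      Finset.sum_eq_zero_iff_of_nonneg fun v _ => Finset.sum_nonneg fun w _ => by
        split_ifs <;> positivity] at h
    have h' := h v (Finset.mem_univ v)
    rw [Finset.sum_eq_zero_iff_of_nonneg fun w _ => by split_ifs <;> positivity] at h'
    have h'' := h' w (Finset.mem_univ w)
    rw [if_pos hvw] at h''
    have := pow_eq_zero_iff (two_ne_zero) |>.1 h''
    linarith

end LazyWalk

/-! ### The chain of occupied sets -/

section SetChain

variable {V : Type*} [Fintype V] [DecidableEq V] (P : Matrix V V ℝ)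

/-- The probability that the vertices make the moves `a : V → V`, when they move independently and
according to the transition matrix `P`. -/
def moveWeight (a : V → V) : ℝ := ∏ v, P v (a v)

/-- The transition operator of the chain of occupied sets: `setStep P f S` is the expected value of
`f` after one step from the set `S` of occupied vertices. -/
def setStep : (Finset V → ℝ) →ₗ[ℝ] (Finset V → ℝ) where
  toFun f S := ∑ a : V → V, moveWeight P a * f (S.image a)
  map_add' f g := by
    ext S
    simp [mul_add, Finset.sum_add_distrib]
  map_smul' c f := by
    ext S
    simp only [Pi.smul_apply, smul_eq_mul, RingHom.id_apply, Finset.mul_sum]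
    exact Finset.sum_congr rfl fun _ _ => by ring

/-- The indicator of the sets with at least `k` elements. -/
def atLeast (k : ℕ) (S : Finset V) : ℝ := if k ≤ S.card then 1 else 0

/-- The number of particles, as a real function of the set of occupied vertices. -/
def cardReal (S : Finset V) : ℝ := S.card

lemma setStep_apply (f : Finset V → ℝ) (S : Finset V) :
    setStep P f S = ∑ a : V → V, moveWeight P a * f (S.image a) := rfl

lemma setStep_pow_succ (f : Finset V → ℝ) (t : ℕ) (S : Finset V) :
    (setStep P ^ (t + 1)) f S = ∑ a : V → V, moveWeight P a * (setStep P ^ t) f (S.image a) := by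
  rw [pow_succ']
  rfl

omit [Fintype V] [DecidableEq V] in
lemma atLeast_nonneg (k : ℕ) (S : Finset V) : 0 ≤ atLeast k S := by
  unfold atLeast; split_ifs <;> norm_num

omit [Fintype V] [DecidableEq V] in
lemma atLeast_le_one (k : ℕ) (S : Finset V) : atLeast k S ≤ 1 := by
  unfold atLeast; split_ifs <;> norm_num

variable {P}

omit [DecidableEq V] in
lemma moveWeight_nonneg (hP : ∀ v w, 0 ≤ P v w) (a : V → V) : 0 ≤ moveWeight P a :=
  Finset.prod_nonneg fun v _ => hP v (a v)

lemma sum_moveWeight (hP1 : ∀ v, ∑ w, P v w = 1) : ∑ a : V → V, moveWeight P a = 1 :=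
  sum_prod_pi_eq_one (fun v w => P v w) hP1

/-- The number of particles does not increase, so that only the sets of at most `k` elements
matter for a start with at most `k` particles. -/
lemma setStep_pow_mono (hP : ∀ v w, 0 ≤ P v w) {f g : Finset V → ℝ} {k : ℕ}
    (hfg : ∀ S : Finset V, S.card ≤ k → f S ≤ g S) (t : ℕ) (S : Finset V) (hS : S.card ≤ k) :
    (setStep P ^ t) f S ≤ (setStep P ^ t) g S := by
  induction t generalizing S with
  | zero => exact hfg S hS
  | succ t ih =>
    rw [setStep_pow_succ, setStep_pow_succ]
    exact Finset.sum_le_sum fun a _ => mul_le_mul_of_nonneg_left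
      (ih _ (Finset.card_image_le.trans hS)) (moveWeight_nonneg hP a)

lemma setStep_pow_mono' (hP : ∀ v w, 0 ≤ P v w) {f g : Finset V → ℝ} (hfg : ∀ S, f S ≤ g S)
    (t : ℕ) (S : Finset V) : (setStep P ^ t) f S ≤ (setStep P ^ t) g S :=
  setStep_pow_mono hP (fun S _ => hfg S) t S le_rfl

lemma setStep_pow_const (hP1 : ∀ v, ∑ w, P v w = 1) (c : ℝ) (t : ℕ) (S : Finset V) :
    (setStep P ^ t) (fun _ => c) S = c := by
  induction t generalizing S with
  | zero => rfl
  | succ t ih =>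
    rw [setStep_pow_succ]
    simp only [ih, ← Finset.sum_mul, sum_moveWeight hP1, one_mul]

lemma setStep_pow_nonneg (hP : ∀ v w, 0 ≤ P v w) (hP1 : ∀ v, ∑ w, P v w = 1)
    {f : Finset V → ℝ} (hf : ∀ S, 0 ≤ f S) (t : ℕ) (S : Finset V) : 0 ≤ (setStep P ^ t) f S := by
  rw [← setStep_pow_const hP1 0 t S]
  exact setStep_pow_mono' hP hf t S

lemma setStep_pow_atLeast_eq_zero (hP : ∀ v w, 0 ≤ P v w) (hP1 : ∀ v, ∑ w, P v w = 1) {k : ℕ}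
    (t : ℕ) (S : Finset V) (hS : S.card < k) : (setStep P ^ t) (atLeast k) S = 0 := by
  refine le_antisymm ?_ (setStep_pow_nonneg hP hP1 (atLeast_nonneg k) t S)
  rw [← setStep_pow_const hP1 0 t S]
  refine setStep_pow_mono (k := S.card) hP (fun S' hS' => ?_) t S le_rfl
  rw [atLeast, if_neg (by omega)]

/-- The moves of distinct vertices are independent. -/
lemma sum_moveWeight_comp (hP1 : ∀ v, ∑ w, P v w = 1) {k : ℕ} (x : Fin k → V)
    (hx : Function.Injective x) (F : (Fin k → V) → ℝ) :
    ∑ a : V → V, moveWeight P a * F (a ∘ x) = ∑ y : Fin k → V, (∏ i, P (x i) (y i)) * F y := by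
  have key : ∀ y : Fin k → V, ∑ a : V → V, moveWeight P a * (if a ∘ x = y then 1 else 0) =
      ∏ i, P (x i) (y i) := by
    intro y
    have e1 : ∀ a : V → V, moveWeight P a * (if a ∘ x = y then 1 else 0) =
        ∏ v, P v (a v) * (if ∀ i, x i = v → a v = y i then 1 else 0) := by
      intro a
      have hiff : a ∘ x = y ↔ ∀ v ∈ Finset.univ, ∀ i, x i = v → a v = y i := by
        constructor
        · rintro h v - i rfl
          exact congrFun h i
        · intro h
          ext i
          exact h (x i) (Finset.mem_univ _) i rfl
      rw [Finset.prod_mul_distrib, moveWeight, Finset.prod_boole]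
      by_cases h : a ∘ x = y
      · rw [if_pos h, if_pos (hiff.1 h)]
      · rw [if_neg h, if_neg fun h' => h (hiff.2 h')]
    simp only [e1]
    rw [← Fintype.prod_sum fun v u => P v u * (if ∀ i, x i = v → u = y i then 1 else 0)]
    have e2 : ∀ v, v ∉ Finset.univ.image x →
        ∑ u, P v u * (if ∀ i, x i = v → u = y i then 1 else 0) = 1 := by
      intro v hv
      refine (Finset.sum_congr rfl fun u _ => ?_).trans (hP1 v)
      rw [if_pos, mul_one]
      intro i hi
      exact absurd (Finset.mem_image.2 ⟨i, Finset.mem_univ i, hi⟩) hv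
    rw [← Finset.prod_subset (Finset.subset_univ (Finset.univ.image x)) fun v _ hv => e2 v hv,
      Finset.prod_image fun i _ j _ h => hx h]
    refine Finset.prod_congr rfl fun i _ => ?_
    have e3 : ∀ u, (∀ j, x j = x i → u = y j) ↔ u = y i := fun u =>
      ⟨fun h => h i rfl, fun h j hj => by rw [hx hj]; exact h⟩
    simp [e3]
  calc ∑ a : V → V, moveWeight P a * F (a ∘ x)
      = ∑ a : V → V, ∑ y, moveWeight P a * (if a ∘ x = y then 1 else 0) * F y := by
        refine Finset.sum_congr rfl fun a _ => ?_
        simp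
    _ = _ := by
        rw [Finset.sum_comm]
        simp only [← Finset.sum_mul, key]

omit [Fintype V] in
lemma card_image_lt_of_not_injective {k : ℕ} {x : Fin k → V} (hx : ¬ Function.Injective x) :
    (Finset.univ.image x).card < k := by
  refine lt_of_le_of_ne (Finset.card_image_le.trans (by simp)) fun h => hx ?_
  have : Set.InjOn x (Finset.univ : Finset (Fin k)) :=
    Finset.card_image_iff.1 (by rw [h, Finset.card_univ, Fintype.card_fin])
  simpa using this

/-- As long as no two of them have met, coalescing particles are independent particles: the
probability that they have not met is dominated by the product chain killed at collisions. -/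
lemma setStep_pow_atLeast_image_le (hP : ∀ v w, 0 ≤ P v w) (hP1 : ∀ v, ∑ w, P v w = 1) {k : ℕ}
    (t : ℕ) (x : Fin k → V) :
    (setStep P ^ (t + 1)) (atLeast k) (Finset.univ.image x) ≤
      Matrix.mulVec (fun x y : Fin k → V => ∏ i, P (x i) (y i))
        (fun y => (setStep P ^ t) (atLeast k) (Finset.univ.image y)) x := by
  by_cases hx : Function.Injective x
  · rw [setStep_pow_succ]
    simp only [Matrix.mulVec, dotProduct, Finset.image_image]
    exact (sum_moveWeight_comp hP1 x hx fun y =>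
      (setStep P ^ t) (atLeast k) (Finset.univ.image y)).le
  · rw [setStep_pow_atLeast_eq_zero hP hP1 _ _ (card_image_lt_of_not_injective hx)]
    exact Finset.sum_nonneg fun y _ => mul_nonneg (Finset.prod_nonneg fun i _ => hP _ _)
      (setStep_pow_nonneg hP hP1 (atLeast_nonneg k) t _)

/-! ### Reduction of the number of particles -/

lemma setStep_pow_subadditive (hP : ∀ v w, 0 ≤ P v w) {f : Finset V → ℝ}
    (hf : ∀ S S', f (S ∪ S') ≤ f S + f S') (t : ℕ) (S S' : Finset V) :
    (setStep P ^ t) f (S ∪ S') ≤ (setStep P ^ t) f S + (setStep P ^ t) f S' := by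
  induction t generalizing S S' with
  | zero => exact hf S S'
  | succ t ih =>
    simp only [setStep_pow_succ, ← Finset.sum_add_distrib, ← mul_add, Finset.image_union]
    exact Finset.sum_le_sum fun a _ => mul_le_mul_of_nonneg_left (ih _ _) (moveWeight_nonneg hP a)

lemma setStep_pow_cardReal_le (hP : ∀ v w, 0 ≤ P v w) (hP1 : ∀ v, ∑ w, P v w = 1) (t : ℕ)
    (S : Finset V) : (setStep P ^ t) cardReal S ≤ S.card := by
  rw [← setStep_pow_const hP1 (S.card : ℝ) t S]
  refine setStep_pow_mono (k := S.card) hP (fun S' hS' => ?_) t S le_rfl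
  simp only [cardReal]
  exact_mod_cast hS'

/-- Split the particles into groups of `k`. If each group loses a particle with probability at
least `1/2`, half as many particles as there are groups are lost in the mean. -/
lemma setStep_pow_cardReal_le_sub (hP : ∀ v w, 0 ≤ P v w) (hP1 : ∀ v, ∑ w, P v w = 1) {k T : ℕ}
    (hk : 1 ≤ k) (hT : ∀ S : Finset V, S.card = k → (setStep P ^ T) (atLeast k) S ≤ 1 / 2)
    (S : Finset V) : (setStep P ^ T) cardReal S ≤ S.card - ((S.card / k : ℕ) : ℝ) / 2 := by
  induction hn : S.card using Nat.strong_induction_on generalizing S with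
  | _ n ih =>
    subst hn
    by_cases hS : S.card < k
    · rw [Nat.div_eq_of_lt hS]
      simpa using setStep_pow_cardReal_le hP hP1 T S
    · obtain ⟨S₁, hS₁, hc⟩ := Finset.exists_subset_card_eq (not_lt.1 hS)
      have hc2 : (S \ S₁).card = S.card - k := by rw [Finset.card_sdiff_of_subset hS₁, hc]
      have h1 : (setStep P ^ T) cardReal S₁ ≤ k - 1 / 2 := by
        have h : (setStep P ^ T) cardReal S₁ ≤
            (setStep P ^ T) ((fun _ => (k : ℝ) - 1) + atLeast k) S₁ := by
          refine setStep_pow_mono (k := k) hP (fun S' hS' => ?_) T S₁ hc.le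
          simp only [cardReal, Pi.add_apply, atLeast]
          have h1 : (S'.card : ℝ) ≤ k := by exact_mod_cast hS'
          split_ifs with h
          · linarith
          · have : (S'.card : ℝ) + 1 ≤ k := by exact_mod_cast (not_le.1 h)
            linarith
        rw [map_add, Pi.add_apply, setStep_pow_const hP1] at h
        linarith [hT S₁ hc]
      have h2 := ih (S \ S₁).card (by omega) (S \ S₁) rfl
      have h3 := setStep_pow_subadditive (f := cardReal) hP
        (fun S S' => by simp only [cardReal]; exact_mod_cast Finset.card_union_le S S')
        T S₁ (S \ S₁)
      rw [Finset.union_sdiff_of_subset hS₁] at h3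
      have h4 : S.card / k = (S.card - k) / k + 1 := Nat.div_eq_sub_div hk (not_lt.1 hS)
      rw [hc2, Nat.cast_sub (not_lt.1 hS)] at h2
      rw [h4]
      push_cast
      linarith

/-- A geometric decrease towards `k` of the mean number of particles. -/
lemma setStep_pow_mul_cardReal_le (hP : ∀ v w, 0 ≤ P v w) (hP1 : ∀ v, ∑ w, P v w = 1) {k T : ℕ}
    (hk : 1 ≤ k) (hT : ∀ S : Finset V, S.card = k → (setStep P ^ T) (atLeast k) S ≤ 1 / 2)
    (r : ℕ) (S : Finset V) :
    (setStep P ^ (T * r)) cardReal S ≤ k + (1 - 1 / (4 * (k : ℝ))) ^ r * S.card := by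
  have hk' : (1 : ℝ) ≤ k := by exact_mod_cast hk
  set β : ℝ := 1 - 1 / (4 * (k : ℝ)) with hβ
  have hinv : 1 / (4 * (k : ℝ)) ≤ 1 := by rw [div_le_one (by positivity)]; linarith
  have hinv0 : 0 ≤ 1 / (4 * (k : ℝ)) := by positivity
  have hβ0 : 0 ≤ β := by linarith
  have hstep : ∀ S : Finset V,
      (setStep P ^ T) cardReal S ≤ (β • cardReal + fun _ => (1 - β) * k : Finset V → ℝ) S := by
    intro S
    simp only [Pi.add_apply, Pi.smul_apply, smul_eq_mul, cardReal]
    have hb : (1 - β) * k = 1 / 4 := by rw [hβ]; field_simp; ring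
    have hb2 : β * S.card = S.card - S.card / (4 * k) := by rw [hβ]; ring
    rw [hb, hb2]
    have hk4 : (S.card : ℝ) / (4 * k) = (S.card : ℝ) / k / 4 := by field_simp
    by_cases hS : S.card < k
    · have : (S.card : ℝ) / k ≤ 1 := by
        rw [div_le_one (by linarith)]
        exact_mod_cast hS.le
      linarith [setStep_pow_cardReal_le hP hP1 T S]
    · have h := setStep_pow_cardReal_le_sub hP hP1 hk hT S
      have h1 : (1 : ℝ) ≤ (S.card / k : ℕ) := by
        exact_mod_cast (Nat.one_le_div_iff hk).2 (not_lt.1 hS)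
      have h2 : (S.card : ℝ) / k ≤ (S.card / k : ℕ) + 1 := by
        rw [div_le_iff₀ (by linarith)]
        have := (Nat.lt_div_mul_add (a := S.card) hk).le
        have h' : S.card ≤ (S.card / k + 1) * k := by rw [add_mul, one_mul]; exact this
        exact_mod_cast h'
      linarith
  induction r with
  | zero =>
    simp only [mul_zero, pow_zero, one_mul, Module.End.one_apply, cardReal]
    linarith
  | succ r ih =>
    rw [mul_add, mul_one, pow_add, Module.End.mul_apply]
    refine (setStep_pow_mono' hP hstep (T * r) S).trans ?_
    rw [map_add, map_smul, Pi.add_apply, Pi.smul_apply, setStep_pow_const hP1, smul_eq_mul]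
    calc β * (setStep P ^ (T * r)) cardReal S + (1 - β) * k
        ≤ β * (k + β ^ r * S.card) + (1 - β) * k := by gcongr
      _ = _ := by ring

/-- Markov's inequality at the end of a geometric decrease: at most `2k + 1` particles are left with
probability at least `1/2`. -/
lemma setStep_pow_atLeast_le_half (hP : ∀ v w, 0 ≤ P v w) (hP1 : ∀ v, ∑ w, P v w = 1) {k T : ℕ}
    (hk : 1 ≤ k) (hT : ∀ S : Finset V, S.card = k → (setStep P ^ T) (atLeast k) S ≤ 1 / 2)
    (r : ℕ) (hr : (1 - 1 / (4 * (k : ℝ))) ^ r * Fintype.card V ≤ 1) (S : Finset V) :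
    (setStep P ^ (T * r)) (atLeast (2 * k + 2)) S ≤ 1 / 2 := by
  have hk' : (1 : ℝ) ≤ k := by exact_mod_cast hk
  have h1 : (setStep P ^ (T * r)) (atLeast (2 * k + 2)) S ≤
      (setStep P ^ (T * r)) ((1 / (2 * (k : ℝ) + 2)) • cardReal) S := by
    refine setStep_pow_mono' hP (fun S' => ?_) _ _
    simp only [atLeast, Pi.smul_apply, smul_eq_mul, cardReal]
    split_ifs with h
    · have : (2 * k + 2 : ℝ) ≤ S'.card := by exact_mod_cast h
      rw [one_div_mul_eq_div, le_div_iff₀ (by linarith)]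
      linarith
    · positivity
  rw [map_smul, Pi.smul_apply, smul_eq_mul] at h1
  refine h1.trans ?_
  have h2 := setStep_pow_mul_cardReal_le hP hP1 hk hT r S
  have hβ0 : 0 ≤ 1 - 1 / (4 * (k : ℝ)) := by
    have : 1 / (4 * (k : ℝ)) ≤ 1 := by rw [div_le_one (by positivity)]; linarith
    linarith
  have h3 : (1 - 1 / (4 * (k : ℝ))) ^ r * S.card ≤ 1 :=
    (mul_le_mul_of_nonneg_left (by exact_mod_cast S.card_le_univ) (pow_nonneg hβ0 r)).trans hr
  rw [one_div_mul_eq_div, div_le_iff₀ (by linarith)]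
  linarith

/-- Ignoring one particle: if `k + 1` particles are left, at least `k` of them come from the
others. -/
lemma setStep_pow_atLeast_insert_le (hP : ∀ v w, 0 ≤ P v w) (k t : ℕ) (a : V) (S : Finset V) :
    (setStep P ^ t) (atLeast (k + 1)) (insert a S) ≤ (setStep P ^ t) (atLeast k) S := by
  induction t generalizing a S with
  | zero =>
    simp only [pow_zero, Module.End.one_apply, atLeast]
    have := Finset.card_insert_le a S
    split_ifs <;> first | omega | norm_num
  | succ t ih =>
    simp only [setStep_pow_succ, Finset.image_insert]
    exact Finset.sum_le_sum fun b _ => mul_le_mul_of_nonneg_left (ih _ _) (moveWeight_nonneg hP b)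

/-! ### The expected coalescence time, by restarts -/

variable (P) in
/-- The expected number of the first `M` time steps at which at least two particles are left, when
the set of occupied vertices is initially `S`. -/
def truncatedTime (M : ℕ) (S : Finset V) : ℝ :=
  ∑ t ∈ Finset.range M, (setStep P ^ t) (atLeast 2) S

lemma truncatedTime_le (hP : ∀ v w, 0 ≤ P v w) (hP1 : ∀ v, ∑ w, P v w = 1) (M T : ℕ)
    (S : Finset V) : truncatedTime P M S ≤ T + (setStep P ^ T) (truncatedTime P M) S := by
  have h0 : ∀ t S, 0 ≤ (setStep P ^ t) (atLeast 2) S := fun t S =>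
    setStep_pow_nonneg hP hP1 (atLeast_nonneg 2) t S
  have h1 : (setStep P ^ T) (truncatedTime P M) S =
      ∑ t ∈ Finset.range M, (setStep P ^ (T + t)) (atLeast 2) S := by
    have : truncatedTime P M = ∑ t ∈ Finset.range M, (setStep P ^ t) (atLeast 2) := by
      ext S
      simp [truncatedTime]
    rw [this, map_sum, Finset.sum_apply]
    exact Finset.sum_congr rfl fun t _ => by rw [pow_add, Module.End.mul_apply]
  have h2 : ∑ t ∈ Finset.range T, (setStep P ^ t) (atLeast 2) S ≤ T := by
    have : ∀ t ∈ Finset.range T, (setStep P ^ t) (atLeast 2) S ≤ 1 := fun t _ => by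
      rw [← setStep_pow_const hP1 1 t S]
      exact setStep_pow_mono' hP (atLeast_le_one 2) t S
    simpa using Finset.sum_le_sum this
  calc truncatedTime P M S ≤ ∑ t ∈ Finset.range (T + M), (setStep P ^ t) (atLeast 2) S :=
        Finset.sum_le_sum_of_subset_of_nonneg (Finset.range_subset_range.2 (by omega))
          fun t _ _ => h0 t S
    _ ≤ _ := by
        rw [Finset.sum_range_add, h1]
        gcongr

/-- If every start with at most `k` particles leads within `T` steps to at most `j` particles with
probability at least `1/2`, then `T` steps have to be tried twice in the mean. -/
lemma truncatedTime_restart (hP : ∀ v w, 0 ≤ P v w) (hP1 : ∀ v, ∑ w, P v w = 1) {M j k T : ℕ}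
    {B : ℝ} (hB : ∀ S : Finset V, S.card ≤ j → truncatedTime P M S ≤ B)
    (hT : ∀ S : Finset V, S.card ≤ k → (setStep P ^ T) (atLeast (j + 1)) S ≤ 1 / 2) :
    ∀ S : Finset V, S.card ≤ k → truncatedTime P M S ≤ 2 * T + B := by
  obtain ⟨S₀, hS₀, hmax⟩ := Finset.exists_max_image
    (Finset.univ.filter fun S : Finset V => S.card ≤ k) (truncatedTime P M) ⟨∅, by simp⟩
  simp only [Finset.mem_filter, Finset.mem_univ, true_and] at hS₀ hmax
  intro S hS
  refine (hmax S hS).trans ?_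
  set U := truncatedTime P M S₀ with hU
  have hT0 : (0 : ℝ) ≤ T := Nat.cast_nonneg T
  by_cases hUB : U ≤ B
  · linarith
  · have h1 : (setStep P ^ T) (truncatedTime P M) S₀ ≤
        (setStep P ^ T) ((fun _ => B) + (U - B) • atLeast (j + 1)) S₀ := by
      refine setStep_pow_mono hP (fun S' hS' => ?_) T S₀ hS₀
      simp only [Pi.add_apply, Pi.smul_apply, smul_eq_mul, atLeast]
      split_ifs with h
      · linarith [hmax S' hS']
      · linarith [hB S' (by omega)]
    rw [map_add, map_smul, Pi.add_apply, Pi.smul_apply, setStep_pow_const hP1, smul_eq_mul] at h1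
    have h2 := truncatedTime_le hP hP1 M T S₀
    have h3 := mul_le_mul_of_nonneg_left (hT S₀ hS₀) (by linarith : 0 ≤ U - B)
    linarith

/-- The last phase, in which the particles are lost one by one. -/
lemma truncatedTime_le_sum (hP : ∀ v w, 0 ≤ P v w) (hP1 : ∀ v, ∑ w, P v w = 1) (T : ℕ → ℕ)
    (hT : ∀ h, 1 ≤ h → ∀ S : Finset V, S.card = h + h →
      (setStep P ^ (T h)) (atLeast (h + h)) S ≤ 1 / 2) (M H : ℕ) :
    ∀ S : Finset V, S.card ≤ 2 * H + 1 →
      truncatedTime P M S ≤ 4 * ∑ h ∈ Finset.range H, (T (h + 1) : ℝ) := by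
  induction H with
  | zero =>
    intro S hS
    simp only [Finset.range_zero, Finset.sum_empty, mul_zero]
    refine (Finset.sum_eq_zero fun t _ => ?_).le
    exact setStep_pow_atLeast_eq_zero hP hP1 t S (by omega)
  | succ H ih =>
    have hT' := hT (H + 1) (by omega)
    rw [show H + 1 + (H + 1) = 2 * H + 2 by ring] at hT'
    -- from `2 H + 2` to `2 H + 1` particles
    have h1 : ∀ S : Finset V, S.card ≤ 2 * H + 2 → truncatedTime P M S ≤ _ :=
      truncatedTime_restart (T := T (H + 1)) hP hP1 ih fun S hS => by
        rcases hS.lt_or_eq with h | h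
        · rw [setStep_pow_atLeast_eq_zero hP hP1 _ S h]
          norm_num
        · exact hT' S h
    -- from `2 H + 3` to `2 H + 2` particles, ignoring one of them
    have h2 : ∀ S : Finset V, S.card ≤ 2 * H + 3 → truncatedTime P M S ≤ _ :=
      truncatedTime_restart (T := T (H + 1)) hP hP1 h1 fun S hS => by
        rcases hS.lt_or_eq with h | h
        · rw [setStep_pow_atLeast_eq_zero hP hP1 _ S h]
          norm_num
        · obtain ⟨a, ha⟩ : S.Nonempty := by rw [← Finset.card_pos]; omega
          rw [← Finset.insert_erase ha]
          refine (setStep_pow_atLeast_insert_le hP _ _ a _).trans (hT' _ ?_)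
          rw [Finset.card_erase_of_mem ha]
          omega
    intro S hS
    refine (h2 S (by omega)).trans (le_of_eq ?_)
    rw [Finset.sum_range_succ]
    ring

/-- The coalescence time from the times `T h` at which `2 h` given particles have met with
probability at least `1/2`: the number of particles first decreases geometrically to about `4 H`,
and then the particles are lost one by one. -/
lemma truncatedTime_le_phases (hP : ∀ v w, 0 ≤ P v w) (hP1 : ∀ v, ∑ w, P v w = 1) (T : ℕ → ℕ)
    (hT : ∀ h, 1 ≤ h → ∀ S : Finset V, S.card = h + h →
      (setStep P ^ (T h)) (atLeast (h + h)) S ≤ 1 / 2) (H r : ℕ) (hH : 1 ≤ H)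
    (hr : (1 - 1 / (8 * (H : ℝ))) ^ r * Fintype.card V ≤ 1) (M : ℕ) (S : Finset V) :
    truncatedTime P M S ≤
      2 * (T H * r) + 4 * ∑ h ∈ Finset.range (2 * H), (T (h + 1) : ℝ) := by
  have h1 := truncatedTime_le_sum hP hP1 T hT M (2 * H)
  have h2 := truncatedTime_restart (k := Fintype.card V) (T := T H * r) hP hP1 h1 fun S _ => by
    have := setStep_pow_atLeast_le_half hP hP1 (by omega) (hT H hH) r
      (by push_cast; rwa [show 4 * ((H : ℝ) + H) = 8 * H by ring]) S
    rwa [show 2 * (H + H) + 2 = 2 * (2 * H) + 1 + 1 by ring] at this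
  have h3 := h2 S S.card_le_univ
  push_cast at h3
  exact h3

end SetChain

/-! ### The laws of the coalescence time and of the voting time -/

section Law

variable {V : Type*} [Fintype V] [DecidableEq V]

/-- The first time at which a persistent property holds is the number of times at which it fails. -/
lemma iInf_natCast_eq_tsum (p : ℕ → Prop) [DecidablePred p] (hp : ∀ t, p t → p (t + 1)) :
    ⨅ (t : ℕ) (_ : p t), (t : ℝ≥0∞) = ∑' t, if p t then 0 else 1 := by
  have hmono : ∀ s t, s ≤ t → p s → p t := fun s t hst hs => by
    induction hst with
    | refl => exact hs
    | step _ ih => exact hp _ ih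
  by_cases h : ∃ t, p t
  · have hfind : ∀ t, p t ↔ Nat.find h ≤ t := fun t =>
      ⟨Nat.find_min' h, fun ht => hmono _ _ ht (Nat.find_spec h)⟩
    rw [tsum_eq_sum (s := Finset.range (Nat.find h))]
    · rw [Finset.sum_congr rfl fun t ht => if_neg fun hpt =>
        absurd ((hfind t).1 hpt) (not_le.2 (Finset.mem_range.1 ht))]
      simp only [Finset.sum_const, Finset.card_range, nsmul_eq_mul, mul_one]
      refine le_antisymm (iInf₂_le _ (Nat.find_spec h)) (le_iInf₂ fun t ht => ?_)
      exact_mod_cast (hfind t).1 ht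
    · intro t ht
      exact if_pos ((hfind t).2 (not_lt.1 fun h' => ht (Finset.mem_range.2 h')))
  · push Not at h
    simp [h]

lemma coalescenceTime_eq_tsum [Nonempty V] (ξ : ℕ → V → V) :
    coalescenceTime ξ = ∑' t, ENNReal.ofReal (atLeast 2 (occupied ξ t)) := by
  have hne : ∀ t, (occupied ξ t).Nonempty := by
    intro t
    induction t with
    | zero => exact Finset.univ_nonempty
    | succ t ih => exact ih.image _
  rw [coalescenceTime, iInf_natCast_eq_tsum]
  · refine tsum_congr fun t => ?_
    have := (hne t).card_pos
    unfold atLeast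
    split_ifs <;> first | omega | simp
  · intro t ht
    have h1 : (occupied ξ (t + 1)).card ≤ (occupied ξ t).card := Finset.card_image_le
    have := (hne (t + 1)).card_pos
    omega

lemma occupied_congr {ξ η : ℕ → V → V} {t : ℕ} (h : ∀ i < t, ξ i = η i) :
    occupied ξ t = occupied η t := by
  induction t with
  | zero => rfl
  | succ t ih =>
    rw [occupied, occupied, ih fun i hi => h i (by omega), h t (by omega)]

/-- The permutation of the times that reverses the first `t` steps. -/
def timeReversal (t i : ℕ) : ℕ := if i < t then t - 1 - i else i

lemma timeReversal_injective (t : ℕ) : Function.Injective (timeReversal t) := by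
  intro i j h
  unfold timeReversal at h
  split_ifs at h <;> omega

omit [Fintype V] [DecidableEq V] in
lemma opinion_succ_eq (ξ : ℕ → V → V) (t : ℕ) :
    opinion ξ (t + 1) = ξ 0 ∘ opinion (fun i => ξ (i + 1)) t := by
  induction t with
  | zero => rfl
  | succ t ih =>
    ext v
    rw [opinion, ih]
    rfl

/-- Traced back in time, the opinions in the voter model move like coalescing random walks. -/
lemma occupied_timeReversal (ξ : ℕ → V → V) (t : ℕ) :
    occupied (fun i => ξ (timeReversal t i)) t = Finset.univ.image (opinion ξ t) := by
  induction t generalizing ξ with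
  | zero =>
    ext v
    simp [occupied, opinion]
  | succ t ih =>
    rw [occupied, opinion_succ_eq, ← Finset.image_image, ← ih,
      occupied_congr (η := fun i => ξ (timeReversal t i + 1)) fun i hi => ?_]
    · simp [timeReversal]
    · simp only [timeReversal, if_pos hi, if_pos (show i < t + 1 by omega)]
      congr 1
      omega

lemma votingTime_eq_tsum [Nonempty V] (ξ : ℕ → V → V) :
    votingTime ξ =
      ∑' t, ENNReal.ofReal (atLeast 2 (occupied (fun i => ξ (timeReversal t i)) t)) := by
  classical
  rw [votingTime, iInf_natCast_eq_tsum]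
  · refine tsum_congr fun t => ?_
    rw [occupied_timeReversal]
    have hpos : 0 < (Finset.univ.image (opinion ξ t)).card :=
      (Finset.univ_nonempty.image _).card_pos
    have hiff : (∃ a, ∀ v, opinion ξ t v = a) ↔ (Finset.univ.image (opinion ξ t)).card = 1 := by
      rw [Finset.card_eq_one]
      constructor
      · rintro ⟨a, ha⟩
        refine ⟨a, Finset.eq_singleton_iff_nonempty_unique_mem.2
          ⟨Finset.univ_nonempty.image _, fun b hb => ?_⟩⟩
        obtain ⟨v, -, rfl⟩ := Finset.mem_image.1 hb
        exact ha v
      · rintro ⟨a, ha⟩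
        exact ⟨a, fun v => Finset.mem_singleton.1
          (ha ▸ Finset.mem_image_of_mem _ (Finset.mem_univ v))⟩
    unfold atLeast
    split_ifs with h1 h2 h2
    · rw [hiff] at h1
      omega
    · simp
    · simp
    · rw [hiff] at h1
      omega
  · rintro t ⟨a, ha⟩
    exact ⟨a, fun v => ha (ξ t v)⟩

variable [MeasurableSpace V] [DiscreteMeasurableSpace V] (G : SimpleGraph V) [DecidableRel G.Adj]

instance : IsProbabilityMeasure (moveLaw G) := by
  unfold moveLaw
  infer_instance

omit [DecidableEq V] in
lemma pi_lazyStep_singleton (a : V → V) :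
    Measure.pi (fun v : V => (lazyStep G v).toMeasure) {a} =
      ENNReal.ofReal (moveWeight (lazyMatrix G) a) := by
  rw [Measure.pi_singleton, moveWeight,
    ENNReal.ofReal_prod_of_nonneg fun v _ => lazyMatrix_nonneg G _ _]
  refine Finset.prod_congr rfl fun v _ => ?_
  rw [PMF.toMeasure_apply_singleton _ _ (measurableSet_singleton _), lazyMatrix, Matrix.of_apply,
    ENNReal.ofReal_toReal (PMF.apply_ne_top _ _)]

/-- The set of occupied vertices at time `t` as a function of the first `t` steps. -/
def occupiedOfRestrict (t : ℕ) (z : Finset.range t → V → V) : Finset V :=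
  occupied (fun i => if h : i ∈ Finset.range t then z ⟨i, h⟩ else id) t

omit [MeasurableSpace V] [DiscreteMeasurableSpace V] in
lemma occupied_eq_occupiedOfRestrict (ξ : ℕ → V → V) (t : ℕ) :
    occupied ξ t = occupiedOfRestrict t (fun i : Finset.range t => ξ i) :=
  occupied_congr fun i hi => by simp [hi]

lemma measurable_comp_occupied (f : Finset V → ℝ≥0∞) (t : ℕ) :
    Measurable fun ξ : ℕ → V → V => f (occupied ξ t) := by
  simp only [occupied_eq_occupiedOfRestrict]
  exact (measurable_of_finite fun z => f (occupiedOfRestrict t z)).comp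
    (measurable_pi_lambda _ fun i => measurable_pi_apply _)

/-- The step at time `t` is independent of the past. -/
lemma lintegral_occupied_mul_step (f : Finset V → ℝ≥0∞) (t : ℕ) (a : V → V) :
    ∫⁻ ξ, f (occupied ξ t) * (if ξ t = a then 1 else 0) ∂(moveLaw G) =
      (∫⁻ ξ, f (occupied ξ t) ∂(moveLaw G)) * ENNReal.ofReal (moveWeight (lazyMatrix G) a) := by
  have hind : ProbabilityTheory.iIndepFun (fun (i : ℕ) (ξ : ℕ → V → V) => ξ i) (moveLaw G) :=
    ProbabilityTheory.iIndepFun_infinitePi (X := fun _ a => a) fun _ => measurable_id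
  have h1 := hind.indepFun_finset (Finset.range t) {t} (by simp) fun i => measurable_pi_apply i
  have hg : Measurable fun a' : V → V => if a' = a then (1 : ℝ≥0∞) else 0 := measurable_of_finite _
  have h2 := h1.comp (φ := fun z => f (occupiedOfRestrict t z))
    (ψ := fun z => if z ⟨t, Finset.mem_singleton_self t⟩ = a then (1 : ℝ≥0∞) else 0)
    (measurable_of_finite _) (measurable_of_finite _)
  have h3 := ProbabilityTheory.lintegral_mul_eq_lintegral_mul_lintegral_of_indepFun''
    ((measurable_comp_occupied f t).aemeasurable)
    ((hg.comp (measurable_pi_apply t)).aemeasurable) (μ := moveLaw G) (by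
      simp only [occupied_eq_occupiedOfRestrict]
      exact h2)
  rw [show ∫⁻ ξ, f (occupied ξ t) * (if ξ t = a then 1 else 0) ∂(moveLaw G) = _ from h3]
  congr 1
  have hpres := measurePreserving_eval_infinitePi
    (fun _ : ℕ => Measure.pi fun v : V => (lazyStep G v).toMeasure) t
  have h4 := hpres.lintegral_comp hg
  refine h4.trans ?_
  rw [← pi_lazyStep_singleton, ← lintegral_indicator_one (measurableSet_singleton a)]
  refine lintegral_congr fun b => ?_
  simp [Set.indicator_apply]

/-- The expected value of a function of the set of occupied vertices. -/
lemma lintegral_occupied (f : Finset V → ℝ) (hf : ∀ S, 0 ≤ f S) (t : ℕ) :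
    ∫⁻ ξ, ENNReal.ofReal (f (occupied ξ t)) ∂(moveLaw G) =
      ENNReal.ofReal ((setStep (lazyMatrix G) ^ t) f Finset.univ) := by
  have hP := lazyMatrix_nonneg G
  have hP1 := sum_lazyMatrix G
  induction t generalizing f with
  | zero => simp [occupied]
  | succ t ih =>
    have hdecomp : ∀ ξ : ℕ → V → V, ENNReal.ofReal (f (occupied ξ (t + 1))) =
        ∑ a : V → V, ENNReal.ofReal (f ((occupied ξ t).image a)) * (if ξ t = a then 1 else 0) := by
      intro ξ
      simp [occupied]
    have hstep : setStep (lazyMatrix G) f =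
        ∑ a : V → V, moveWeight (lazyMatrix G) a • fun S : Finset V => f (S.image a) := by
      ext S
      simp [setStep_apply]
    have hmeas : ∀ a : V → V, Measurable fun ξ : ℕ → V → V =>
        ENNReal.ofReal (f ((occupied ξ t).image a)) * (if ξ t = a then 1 else 0) := fun a =>
      (measurable_comp_occupied (fun S => ENNReal.ofReal (f (S.image a))) t).mul
        ((measurable_of_finite fun a' : V → V => if a' = a then (1 : ℝ≥0∞) else 0).comp
          (measurable_pi_apply t))
    simp only [hdecomp]
    rw [lintegral_finsetSum _ fun a _ => hmeas a,
      pow_succ, Module.End.mul_apply, hstep, map_sum, Finset.sum_apply,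
      ENNReal.ofReal_sum_of_nonneg fun a _ => ?_]
    · refine Finset.sum_congr rfl fun a _ => ?_
      rw [lintegral_occupied_mul_step G (fun S => ENNReal.ofReal (f (S.image a))),
        ih (fun S => f (S.image a)) fun S => hf _, map_smul, Pi.smul_apply, smul_eq_mul, mul_comm,
        ENNReal.ofReal_mul (moveWeight_nonneg hP a)]
    · rw [map_smul, Pi.smul_apply, smul_eq_mul]
      exact mul_nonneg (moveWeight_nonneg hP a) (setStep_pow_nonneg hP hP1 (fun S => hf _) t _)

lemma expectedCoalescenceTime_eq_tsum [Nonempty V] : expectedCoalescenceTime G =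
    ∑' t, ∫⁻ ξ, ENNReal.ofReal (atLeast 2 (occupied ξ t)) ∂(moveLaw G) := by
  simp only [expectedCoalescenceTime, coalescenceTime_eq_tsum]
  exact lintegral_tsum fun t =>
    (measurable_comp_occupied (fun S => ENNReal.ofReal (atLeast 2 S)) t).aemeasurable

/-- The law of the moves is invariant under a reversal of time, which turns the voter model into
coalescing random walks. -/
theorem expectedVotingTime_eq [Nonempty V] : expectedVotingTime G = expectedCoalescenceTime G := by
  rw [expectedCoalescenceTime_eq_tsum]
  simp only [expectedVotingTime, votingTime_eq_tsum]
  have hmeas : ∀ t, Measurable fun ξ : ℕ → V → V => fun i => ξ (timeReversal t i) := fun t =>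
    measurable_pi_lambda _ fun i => measurable_pi_apply _
  have hf := measurable_comp_occupied (V := V) fun S => ENNReal.ofReal (atLeast 2 S)
  refine (lintegral_tsum fun t => ((hf t).comp (hmeas t)).aemeasurable).trans ?_
  refine tsum_congr fun t => ?_
  have hmap : (moveLaw G).map (fun ξ i => ξ (timeReversal t i)) = moveLaw G :=
    Measure.map_infinitePi_infinitePi_of_inj (timeReversal_injective t)
  conv_rhs => rw [← hmap]
  exact (lintegral_map (hf t) (hmeas t)).symm

lemma expectedCoalescenceTime_le [Nonempty V] {B : ℝ}
    (hB : ∀ M, truncatedTime (lazyMatrix G) M Finset.univ ≤ B) :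
    expectedCoalescenceTime G ≤ ENNReal.ofReal B := by
  rw [expectedCoalescenceTime_eq_tsum, ENNReal.tsum_eq_iSup_nat]
  refine iSup_le fun M => ?_
  simp only [lintegral_occupied G _ (atLeast_nonneg 2)]
  rw [← ENNReal.ofReal_sum_of_nonneg fun t _ => setStep_pow_nonneg (lazyMatrix_nonneg G)
    (sum_lazyMatrix G) (atLeast_nonneg 2) t _]
  exact ENNReal.ofReal_le_ofReal (hB M)

end Law

/-! ### Meeting times and the bound -/

section Bound

variable {V : Type*} [Fintype V] [DecidableEq V] {G : SimpleGraph V} [DecidableRel G.Adj]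

/-- Among `2h` particles two have met with probability at least `1/2` after a time of order
`(h log n + 1 / (h² ∑ π²)) / (1 - λ₂)`: the first term is the time to mix, the second one the time
that the stationary chain needs to hit the set of the collisions. -/
lemma exists_meeting_time (hG : G.Connected) (hn : 2 ≤ Fintype.card V) (h : ℕ) (hh : 1 ≤ h) :
    ∃ T : ℕ, (T : ℝ) ≤ (22 * h * Real.log (Fintype.card V) +
        6 / ((h : ℝ) ^ 2 * ∑ v, stationary G v ^ 2)) / (1 - lambdaTwo G) ∧
      ∀ S : Finset V, S.card = h + h →
        (setStep (lazyMatrix G) ^ T) (atLeast (h + h)) S ≤ 1 / 2 := by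
  obtain ⟨hl0, hl1, hcon⟩ := lazyMatrix_l2Contracts hG hn
  set l := lambdaTwo G with hl
  set n := Fintype.card V with hn'
  set π := stationary G with hπ
  have hπ0 := stationary_pos hG hn
  have hπ1 := sum_stationary hG hn
  have hP := lazyMatrix_nonneg G
  have hP1 := sum_lazyMatrix G
  have hnR : (2 : ℝ) ≤ n := by exact_mod_cast hn
  set ℓ := Real.log n with hℓ
  have hℓ1 : 1 / 2 ≤ ℓ := by
    have := Real.log_le_log (by norm_num) hnR
    linarith [Real.log_two_gt_d9]
  have hhR : (1 : ℝ) ≤ h := by exact_mod_cast hh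
  have hgap : 0 < 1 - l := by linarith
  set p := ∑ v, π v ^ 2 with hp
  have hp0 : 0 < p := by
    have := hG.nonempty
    exact Finset.sum_pos (fun v _ => pow_pos (hπ0 v) 2) Finset.univ_nonempty
  have hm0 : 0 < (h : ℝ) ^ 2 * p := by positivity
  set m := (h : ℝ) ^ 2 * p with hm
  set q := ∑ x : Fin (h + h) → V, (∏ i, π (x i)) * (if Function.Injective x then (0 : ℝ) else 1)
    with hq
  have hcol : m ≤ 2 * (1 + m) * q :=
    collision_lower_bound π (fun v => (hπ0 v).le) hπ1 h hm0
  set μ : (Fin (h + h) → V) → ℝ := fun x => ∏ i, π (x i) with hμ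
  have hμ0 : ∀ x, 0 < μ x := fun x => Finset.prod_pos fun i _ => hπ0 _
  have hμ1 : ∑ x, μ x = 1 := sum_prod_pi_const π hπ1 _
  have hA : ∑ x, μ x * (if Function.Injective x then 1 else 0) = 1 - q := by
    rw [eq_sub_iff_add_eq, hq, ← Finset.sum_add_distrib]
    refine (Finset.sum_congr rfl fun x _ => ?_).trans hμ1
    split_ifs <;> simp [hμ]
  have hq0 : 0 ≤ q := Finset.sum_nonneg fun x _ =>
    mul_nonneg (hμ0 x).le (by split_ifs <;> norm_num)
  have hq1 : q ≤ 1 := by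
    have : 0 ≤ ∑ x, μ x * (if Function.Injective x then 1 else 0) := Finset.sum_nonneg fun x _ =>
      mul_nonneg (hμ0 x).le (by split_ifs <;> norm_num)
    linarith
  have hc0 : 0 ≤ l ^ 2 := sq_nonneg l
  have hc1 : l ^ 2 ≤ l := by nlinarith
  -- `s` steps to mix, as `μ x ≥ n ^ (-4 h)`, and `t` steps to hit the collisions, as `1 / q` is at
  -- most `2 (1 + 1 / m)`
  set s := ⌈(2 * h * ℓ + 2) / (1 - l)⌉₊ with hs
  set t := ⌈6 * (1 + 1 / m) / (1 - l)⌉₊ with ht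
  have hs1 : 2 * h * ℓ + 2 ≤ (1 - l) * s := by
    rw [← div_le_iff₀' hgap]
    exact Nat.le_ceil _
  have ht1 : 6 * (1 + 1 / m) ≤ (1 - l) * t := by
    rw [← div_le_iff₀' hgap]
    exact Nat.le_ceil _
  refine ⟨t + s, ?_, fun S hS => ?_⟩
  · have h1 : (s : ℝ) ≤ (2 * h * ℓ + 2) / (1 - l) + 1 :=
      (Nat.ceil_lt_add_one (by positivity)).le
    have h2 : (t : ℝ) ≤ 6 * (1 + 1 / m) / (1 - l) + 1 :=
      (Nat.ceil_lt_add_one (by positivity)).le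
    have h3 : (1 : ℝ) ≤ 1 / (1 - l) := by rw [le_div_iff₀ hgap]; linarith
    have h4 : 1 / 2 ≤ h * ℓ := by nlinarith
    push_cast
    calc (t : ℝ) + s
        ≤ 6 * (1 + 1 / m) / (1 - l) + (2 * h * ℓ + 2) / (1 - l) + 2 * (1 / (1 - l)) := by
          linarith
      _ = (2 * (h * ℓ) + 10 + 6 / m) / (1 - l) := by ring
      _ ≤ (22 * h * ℓ + 6 / m) / (1 - l) := by
          gcongr
          linarith
  · obtain ⟨x, hx⟩ : ∃ x : Fin (h + h) → V, Finset.univ.image x = S := by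
      refine ⟨fun i => (S.equivFinOfCardEq hS).symm i, ?_⟩
      ext v
      simp only [Finset.mem_image, Finset.mem_univ, true_and]
      constructor
      · rintro ⟨i, rfl⟩
        exact Subtype.coe_prop _
      · intro hv
        exact ⟨S.equivFinOfCardEq hS ⟨v, hv⟩, by simp⟩
    have hkill := killed_le (μ := μ)
      (Q := fun x y : Fin (h + h) → V => ∏ i, lazyMatrix G (x i) (y i))
      hc0 (by linarith) hμ0 hμ1
      (L2Contracts.pi hc0 (by linarith) (fun v => (hπ0 v).le) hπ1 hcon (h + h))
      (fun x y => Finset.prod_nonneg fun i _ => hP _ _)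
      (fun x => sum_prod_pi_eq_one (fun i w => lazyMatrix G (x i) w) fun i => hP1 (x i))
      (fun y => by
        simp only [hμ, ← Finset.prod_mul_distrib]
        rw [← Fintype.prod_sum fun i v => π v * lazyMatrix G v (y i)]
        exact Finset.prod_congr rfl fun i _ => stationary_stationary hG hn (y i))
      Function.Injective hA hq0 hq1
      (fun t y => (setStep (lazyMatrix G) ^ t) (atLeast (h + h)) (Finset.univ.image y))
      (fun t y => setStep_pow_nonneg hP hP1 (atLeast_nonneg _) t _)
      (fun t y hy => setStep_pow_atLeast_eq_zero hP hP1 t _ (card_image_lt_of_not_injective hy))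
      (by
        rw [← hμ1]
        refine Finset.sum_le_sum fun y _ => mul_le_of_le_one_right (hμ0 y).le ?_
        exact pow_le_one₀ (atLeast_nonneg _ _) (atLeast_le_one _ _))
      (fun t y => setStep_pow_atLeast_image_le hP hP1 t y) s t x
    simp only [hx] at hkill
    have hexp3 : Real.exp (-3) ≤ 1 / 16 := by
      rw [Real.exp_neg, inv_eq_one_div]
      refine one_div_le_one_div_of_le (by norm_num) ?_
      have := Real.exp_one_gt_d9
      calc (16 : ℝ) ≤ 2.7 ^ 3 := by norm_num
        _ ≤ Real.exp 1 ^ 3 := by gcongr; linarith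
        _ = Real.exp 3 := by rw [← Real.exp_nat_mul]; norm_num
    have hsqrt : ∀ y : ℝ, y ≤ 1 / 16 → Real.sqrt y ≤ 1 / 4 := fun y hy => by
      rw [Real.sqrt_le_left (by norm_num)]
      linarith
    have hb1 : (1 - (1 - l ^ 2) * q) ^ t ≤ 1 / 16 := by
      have hqt : 3 ≤ (1 - l) * q * t := by
        have e1 : (1 + 1 / m) * m = 1 + m := by
          field_simp
          ring
        have e2 : 3 * (2 * (1 + m)) ≤ (1 - l) * t * (2 * (1 + m) * q) := by
          calc 3 * (2 * (1 + m)) = 6 * (1 + 1 / m) * m := by rw [mul_assoc, e1]; ring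
            _ ≤ (1 - l) * t * (2 * (1 + m) * q) := by gcongr
        have e3 : 3 * (2 * (1 + m)) ≤ ((1 - l) * q * t) * (2 * (1 + m)) := by linarith
        exact le_of_mul_le_mul_right e3 (by positivity)
      calc (1 - (1 - l ^ 2) * q) ^ t ≤ Real.exp (-((1 - l) * q)) ^ t := by
            have hn0 : 0 ≤ 1 - (1 - l ^ 2) * q := by nlinarith
            refine pow_le_pow_left₀ hn0 ?_ t
            have := Real.add_one_le_exp (-((1 - l) * q))
            nlinarith
        _ = Real.exp (-((1 - l) * q * t)) := by
            rw [← Real.exp_nat_mul]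
            congr 1
            ring
        _ ≤ Real.exp (-3) := Real.exp_le_exp.2 (by linarith)
        _ ≤ 1 / 16 := hexp3
    have hb2 : (l ^ 2) ^ s / μ x ≤ 1 / 16 := by
      have hμx : Real.exp (-(4 * h * ℓ)) ≤ μ x := by
        calc Real.exp (-(4 * h * ℓ)) = ∏ _i : Fin (h + h), ((n : ℝ) ^ 2)⁻¹ := by
              rw [Finset.prod_const, Finset.card_univ, Fintype.card_fin, Real.exp_neg, inv_pow,
                ← pow_mul]
              congr 1
              conv_rhs => rw [← Real.exp_log (show (0 : ℝ) < n by linarith), ← Real.exp_nat_mul]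
              congr 1
              push_cast
              ring
          _ ≤ μ x := Finset.prod_le_prod (fun i _ => by positivity) fun i _ =>
              inv_sq_le_stationary hG hn (x i)
      have hls : (l ^ 2) ^ s ≤ Real.exp (-(2 * ((1 - l) * s))) := by
        rw [← pow_mul]
        calc l ^ (2 * s) ≤ Real.exp (-(1 - l)) ^ (2 * s) := by
              refine pow_le_pow_left₀ hl0 ?_ _
              have := Real.add_one_le_exp (-(1 - l))
              linarith
          _ = _ := by
              rw [← Real.exp_nat_mul]
              congr 1
              push_cast
              ring
      rw [div_le_iff₀ (hμ0 x)]
      calc (l ^ 2) ^ s ≤ Real.exp (-(2 * ((1 - l) * s))) := hls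
        _ ≤ Real.exp (-3 + -(4 * h * ℓ)) := Real.exp_le_exp.2 (by linarith)
        _ = Real.exp (-3) * Real.exp (-(4 * h * ℓ)) := Real.exp_add _ _
        _ ≤ 1 / 16 * μ x := by gcongr
    linarith [hsqrt _ hb1, hsqrt _ hb2]

lemma sum_inv_sq_le (N : ℕ) : ∑ h ∈ Finset.range N, 1 / ((h : ℝ) + 1) ^ 2 ≤ 2 := by
  have key : ∀ N : ℕ,
      ∑ h ∈ Finset.range (N + 1), 1 / ((h : ℝ) + 1) ^ 2 ≤ 2 - 1 / ((N : ℝ) + 1) := by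
    intro N
    induction N with
    | zero => norm_num
    | succ N ih =>
      rw [Finset.sum_range_succ]
      push_cast
      have h1 : 1 / ((N : ℝ) + 1 + 1) ^ 2 ≤ 1 / ((N : ℝ) + 1) - 1 / ((N : ℝ) + 1 + 1) := by
        rw [div_sub_div _ _ (by positivity) (by positivity),
          div_le_div_iff₀ (by positivity) (by positivity)]
        have : (0 : ℝ) ≤ N := Nat.cast_nonneg N
        nlinarith
      linarith
  have h1 : (0 : ℝ) ≤ 1 / ((N : ℝ) + 1) := by positivity
  have h2 : (0 : ℝ) ≤ 1 / ((N : ℝ) + 1) ^ 2 := by positivity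
  have h3 := key N
  rw [Finset.sum_range_succ] at h3
  linarith

lemma sum_succ_le_sq (N : ℕ) : ∑ h ∈ Finset.range N, ((h : ℝ) + 1) ≤ (N : ℝ) ^ 2 := by
  calc ∑ h ∈ Finset.range N, ((h : ℝ) + 1) ≤ ∑ _h ∈ Finset.range N, (N : ℝ) :=
        Finset.sum_le_sum fun h hh => by exact_mod_cast Finset.mem_range.1 hh
    _ = (N : ℝ) ^ 2 := by simp [pow_two]

/-- The first phase works with groups of `2 ⌈log n⌉` particles. -/
lemma truncatedTime_bound (hG : G.Connected) (hn : 2 ≤ Fintype.card V) (M : ℕ) :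
    truncatedTime (lazyMatrix G) M Finset.univ ≤ 11000 * (1 / (1 - lambdaTwo G) *
      (Real.log (Fintype.card V) ^ 4 + Fintype.card V / degreeVariability G)) := by
  rw [card_div_degreeVariability hn]
  have hgap : 0 < 1 - lambdaTwo G := by linarith [(lazyMatrix_l2Contracts hG hn).2.1]
  have hnR : (2 : ℝ) ≤ Fintype.card V := by exact_mod_cast hn
  have hℓ1 : 1 / 2 ≤ Real.log (Fintype.card V) := by
    have := Real.log_le_log (by norm_num) hnR
    linarith [Real.log_two_gt_d9]
  have hexp : Real.exp (-Real.log (Fintype.card V)) * Fintype.card V = 1 := by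
    rw [Real.exp_neg, Real.exp_log (by linarith), inv_mul_cancel₀ (by linarith)]
  have hp0 : 0 < ∑ v, stationary G v ^ 2 := by
    have := hG.nonempty
    exact Finset.sum_pos (fun v _ => pow_pos (stationary_pos hG hn v) 2) Finset.univ_nonempty
  have hmeet : ∀ h : ℕ, ∃ T : ℕ, 1 ≤ h → (T : ℝ) ≤ (22 * h * Real.log (Fintype.card V) +
        6 / ((h : ℝ) ^ 2 * ∑ v, stationary G v ^ 2)) / (1 - lambdaTwo G) ∧
      ∀ S : Finset V, S.card = h + h →
        (setStep (lazyMatrix G) ^ T) (atLeast (h + h)) S ≤ 1 / 2 := fun h => by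
    by_cases hh : 1 ≤ h
    · obtain ⟨T, hT⟩ := exists_meeting_time hG hn h hh
      exact ⟨T, fun _ => hT⟩
    · exact ⟨0, fun h' => absurd h' hh⟩
  choose T hT using hmeet
  set ℓ := Real.log (Fintype.card V) with hℓ
  set p := ∑ v, stationary G v ^ 2 with hp
  set g := 1 - lambdaTwo G with hg
  set H := ⌈ℓ⌉₊ with hH
  have hℓH : ℓ ≤ H := Nat.le_ceil _
  have hH1 : 1 ≤ H := Nat.one_le_ceil_iff.2 (by linarith)
  have hH1R : (1 : ℝ) ≤ H := by exact_mod_cast hH1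
  have hH3 : (H : ℝ) ≤ 3 * ℓ := by
    have := (Nat.ceil_lt_add_one (show 0 ≤ ℓ by linarith)).le
    linarith
  set r := ⌈8 * H * ℓ⌉₊ with hr
  have hr1 : 8 * H * ℓ ≤ r := Nat.le_ceil _
  have hr2 : (r : ℝ) ≤ 10 * H * ℓ := by
    have := (Nat.ceil_lt_add_one (show 0 ≤ 8 * H * ℓ by positivity)).le
    nlinarith
  have hdec : (1 - 1 / (8 * (H : ℝ))) ^ r * Fintype.card V ≤ 1 := by
    have h0 : 0 ≤ 1 - 1 / (8 * (H : ℝ)) := by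
      have : 1 / (8 * (H : ℝ)) ≤ 1 := by rw [div_le_one (by positivity)]; linarith
      linarith
    have h1 : (1 - 1 / (8 * (H : ℝ))) ^ r ≤ Real.exp (-ℓ) := by
      calc (1 - 1 / (8 * (H : ℝ))) ^ r ≤ Real.exp (-(1 / (8 * (H : ℝ)))) ^ r := by
            refine pow_le_pow_left₀ h0 ?_ r
            have := Real.add_one_le_exp (-(1 / (8 * (H : ℝ))))
            linarith
        _ = Real.exp (-(r / (8 * (H : ℝ)))) := by
            rw [← Real.exp_nat_mul]
            congr 1
            ring
        _ ≤ Real.exp (-ℓ) := by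
            refine Real.exp_le_exp.2 (neg_le_neg ?_)
            rw [le_div_iff₀ (by positivity)]
            linarith
    calc _ ≤ Real.exp (-ℓ) * Fintype.card V := mul_le_mul_of_nonneg_right h1 (by linarith)
      _ = 1 := hexp
  refine (truncatedTime_le_phases (lazyMatrix_nonneg G) (sum_lazyMatrix G) T
    (fun h hh => (hT h hh).2) H r hH1 hdec M Finset.univ).trans ?_
  have hTH := (hT H hH1).1
  have hphase1 : 2 * (T H * r : ℝ) ≤ (3960 * ℓ ^ 4 + 120 * p⁻¹) / g := by
    have e1 : (T H : ℝ) * r ≤ (22 * H * ℓ + 6 / ((H : ℝ) ^ 2 * p)) / g * (10 * H * ℓ) := by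
      gcongr
    have e2 : (22 * H * ℓ + 6 / ((H : ℝ) ^ 2 * p)) / g * (10 * H * ℓ) =
        (220 * (H * ℓ) ^ 2 + 60 * (ℓ / H) * p⁻¹) / g := by
      field_simp
      ring
    have e3 : (H * ℓ) ^ 2 ≤ (3 * ℓ * ℓ) ^ 2 := by gcongr
    have e4 : ℓ / H * p⁻¹ ≤ p⁻¹ :=
      mul_le_of_le_one_left (by positivity) (by rw [div_le_one (by linarith)]; exact hℓH)
    calc 2 * (T H * r : ℝ) ≤ 2 * ((220 * (H * ℓ) ^ 2 + 60 * (ℓ / H) * p⁻¹) / g) := by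
          rw [← e2]; linarith
      _ = (440 * (H * ℓ) ^ 2 + 120 * (ℓ / H * p⁻¹)) / g := by ring
      _ ≤ (440 * (3 * ℓ * ℓ) ^ 2 + 120 * p⁻¹) / g := by gcongr
      _ = _ := by ring
  have hphase2 : 4 * ∑ h ∈ Finset.range (2 * H), (T (h + 1) : ℝ) ≤
      (6336 * ℓ ^ 4 + 48 * p⁻¹) / g := by
    have e1 : ∑ h ∈ Finset.range (2 * H), (T (h + 1) : ℝ) ≤ ∑ h ∈ Finset.range (2 * H),
        (22 * ℓ / g * ((h : ℝ) + 1) + 6 * p⁻¹ / g * (1 / ((h : ℝ) + 1) ^ 2)) := by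
      refine Finset.sum_le_sum fun h _ => ((hT (h + 1) (by omega)).1).trans (le_of_eq ?_)
      push_cast
      field_simp
    rw [Finset.sum_add_distrib, ← Finset.mul_sum, ← Finset.mul_sum] at e1
    have e2 : 22 * ℓ / g * ∑ h ∈ Finset.range (2 * H), ((h : ℝ) + 1) ≤
        22 * ℓ / g * (2 * (3 * ℓ)) ^ 2 := by
      refine mul_le_mul_of_nonneg_left ((sum_succ_le_sq _).trans ?_) (by positivity)
      push_cast
      gcongr
    have e3 : 6 * p⁻¹ / g * ∑ h ∈ Finset.range (2 * H), 1 / ((h : ℝ) + 1) ^ 2 ≤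
        6 * p⁻¹ / g * 2 :=
      mul_le_mul_of_nonneg_left (sum_inv_sq_le _) (by positivity)
    have e4 : ℓ ^ 3 ≤ 2 * ℓ ^ 4 := by
      have : 0 ≤ ℓ ^ 3 * (2 * ℓ - 1) := mul_nonneg (by positivity) (by linarith)
      linarith
    calc 4 * ∑ h ∈ Finset.range (2 * H), (T (h + 1) : ℝ)
        ≤ 4 * (22 * ℓ / g * (2 * (3 * ℓ)) ^ 2 + 6 * p⁻¹ / g * 2) := by linarith
      _ = (3168 * ℓ ^ 3 + 48 * p⁻¹) / g := by ring
      _ ≤ (6336 * ℓ ^ 4 + 48 * p⁻¹) / g := by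
          refine div_le_div_of_nonneg_right ?_ hgap.le
          linarith
  calc _ ≤ (3960 * ℓ ^ 4 + 120 * p⁻¹) / g + (6336 * ℓ ^ 4 + 48 * p⁻¹) / g :=
        add_le_add hphase1 hphase2
    _ = (10296 * ℓ ^ 4 + 168 * p⁻¹) / g := by ring
    _ ≤ (11000 * ℓ ^ 4 + 11000 * p⁻¹) / g := by gcongr <;> norm_num
    _ = _ := by ring

end Bound

end

theorem theorem1 :
    ∃ K : ℝ, 0 < K ∧
      ∀ (V : Type*) [Fintype V] [DecidableEq V] [MeasurableSpace V] [DiscreteMeasurableSpace V]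
        (G : SimpleGraph V) [DecidableRel G.Adj],
        G.Connected → 2 ≤ Fintype.card V →
          expectedCoalescenceTime G ≤
              ENNReal.ofReal (K * (1 / (1 - lambdaTwo G) *
                (Real.log (Fintype.card V) ^ 4 + Fintype.card V / degreeVariability G))) ∧
          expectedVotingTime G = expectedCoalescenceTime G ∧
          expectedVotingTime G ≤
              ENNReal.ofReal (K * (1 / (1 - lambdaTwo G) *
                (Real.log (Fintype.card V) ^ 4 + Fintype.card V / degreeVariability G))) := by
  refine ⟨11000, by norm_num, fun V _ _ _ _ G _ hG hn => ?_⟩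
  have := hG.nonempty
  have hC := expectedCoalescenceTime_le G (truncatedTime_bound hG hn)
  have hV := expectedVotingTime_eq G
  exact ⟨hC, hV, hV ▸ hC⟩
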